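/- Let $k$ be a field and let $V$ be a vector space over $k$ of finite dimension $n\ge 2$. For integers $t,p\ge 1$ put $$T_t^p=\bigoplus_{\substack{i_1,\dots,i_p\ge 1\\ i_1+\dots+i_p=t}}\wedge^{i_1}V\otimes\cdots\otimes\wedge^{i_p}V .$$ For $v_1,\dots,v_i\in V$ and a nonempty set $A=\{a_1<\dots<a_j\}\subset\{1,\dots,i\}$ write $v_A=v_{a_1}\wedge\dots\wedge v_{a_j}\in\wedge^jV$, and for disjoint nonempty $A,B\subset\{1,\dots,i\}$ let $s(A,B)\in\{1,-1\}$ be the sign $(-1)^{\#\{(a,b)\in A\times B\,:\,b<a\}}$, so that $v_{A\cup B}=s(A,B)\,v_A\wedge v_B$. Define a linear map $\delta:\wedge^iV=T_i^1\to T_i^2$ by $$\delta(v_1\wedge\dots\wedge v_i)=\sum_{\substack{A,B\ne\emptyset,\ A\cap B=\emptyset\\ A\cup B=\{1,\dots,i\}}}s(A,B)\,v_A\otimes v_B,$$ and extend it to linear maps $\delta:T_t^p\to T_t^{p+1}$ by $$\delta(\alpha_1\otimes\cdots\otimes\alpha_p)=\sum_{j=1}^{p}(-1)^{j-1}\,\alpha_1\otimes\cdots\otimes\delta(\alpha_j)\otimes\cdots\otimes\alpha_p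 ,\qquad \alpha_j\in\wedge^{i_j}V.$$ Finally let $\pi:T_t^t=V^{\otimes t}\to S^tV$ be the natural projection onto the $t$-th symmetric power of $V$. Then for every $t\ge 1$ the sequence $$0\to T_t^1\xrightarrow{\ \delta\ }T_t^2\xrightarrow{\ \delta\ }\cdots\xrightarrow{\ \delta\ }T_t^t\xrightarrow{\ \pi\ }S^tV\to 0$$ is a complex and is exact. -/

import Mathlib

open scoped TensorProduct DirectSum

noncomputable section

namespace KoszulInversion

/-! ### The terms of the complex -/

/-- `l = (i₁, …, i_p)` is a composition of `t` into `p` parts: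
all `i_j ≥ 1`, `i₁ + ⋯ + i_p = t`. -/
def IsComposition (t p : ℕ) (l : List ℕ) : Prop :=
  (∀ i ∈ l, 1 ≤ i) ∧ l.sum = t ∧ l.length = p

section Terms

variable (k V : Type*) [CommRing k] [AddCommGroup V] [Module k V]

/-- `⋀^{i₁} V ⊗ ⋯ ⊗ ⋀^{i_p} V` for the list `l = (i₁, …, i_p)`. -/
abbrev WordTensor (l : List ℕ) : Type _ :=
  ⨂[k] j : Fin l.length, ⋀[k]^(l.get j) V

/-- `T_t^p`, the direct sum of `⋀^{i₁} V ⊗ ⋯ ⊗ ⋀^{i_p} V` over all compositions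
`(i₁, …, i_p)` of `t` into `p` parts. -/
abbrev T (t p : ℕ) : Type _ :=
  ⨁ c : {l : List ℕ // IsComposition t p l}, WordTensor k V c.1

instance (t p : ℕ) : AddCommGroup (T k V t p) := Module.addCommMonoidToAddCommGroup k

/-- `S^t V`, the degree `t` part of the symmetric algebra (as in Mathlib's definition of
`⋀[k]^t V` as a submodule of the exterior algebra). -/
abbrev SymPower (t : ℕ) : Submodule k (SymmetricAlgebra k V) :=
  LinearMap.range (SymmetricAlgebra.ι k V) ^ t

variable {k V}

/-- The inclusion of a direct summand into `T_t^p`. -/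
def incl {t p : ℕ} (l : List ℕ) (h : IsComposition t p l) : WordTensor k V l →ₗ[k] T k V t p :=
  DirectSum.lof k {l : List ℕ // IsComposition t p l} (fun c => WordTensor k V c.1) ⟨l, h⟩

/-- `α ↦ β ↦ α ⊗ β` for `α ∈ ⋀^i V` and `β ∈ ⋀^{i₁} V ⊗ ⋯ ⊗ ⋀^{i_p} V`. -/
def cons (i : ℕ) (l : List ℕ) :
    ⋀[k]^i V →ₗ[k] WordTensor k V l →ₗ[k] WordTensor k V (i :: l) :=
  (PiTensorProduct.lift (R := k) (s := fun j : Fin l.length => ⋀[k]^(l.get j) V)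
      (E := WordTensor k V (i :: l))).toLinearMap ∘ₗ
    (PiTensorProduct.tprod k (s := fun j : Fin (l.length + 1) =>
      ⋀[k]^((i :: l).get j) V)).curryLeft

/-- The linear map out of `⋀^i V ⊗ (⋀^{i₁} V ⊗ ⋯ ⊗ ⋀^{i_p} V)` given by a bilinear map `g`,
i.e. `α ⊗ β ↦ g α β`. -/
def uncons {N : Type*} [AddCommMonoid N] [Module k N] (i : ℕ) (l : List ℕ)
    (g : ⋀[k]^i V →ₗ[k] WordTensor k V l →ₗ[k] N) : WordTensor k V (i :: l) →ₗ[k] N :=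
  PiTensorProduct.lift (R := k) (s := fun j : Fin (l.length + 1) => ⋀[k]^((i :: l).get j) V)
    (LinearMap.uncurryLeft (M := fun j : Fin (l.length + 1) => ⋀[k]^((i :: l).get j) V)
      ((PiTensorProduct.lift (R := k) (s := fun j : Fin l.length => ⋀[k]^(l.get j) V)
        (E := N)).symm.toLinearMap ∘ₗ g))

theorem cons_tprod (i : ℕ) (l : List ℕ) (a : ⋀[k]^i V)
    (x : ∀ j : Fin l.length, ⋀[k]^(l.get j) V) :
    cons i l a (PiTensorProduct.tprod k x) =
      PiTensorProduct.tprod k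
        (Fin.cons (α := fun j : Fin (l.length + 1) => ⋀[k]^((i :: l).get j) V) a x) := by
  simp only [cons]
  erw [PiTensorProduct.lift.tprod]
  rfl

theorem uncons_cons {N : Type*} [AddCommMonoid N] [Module k N] (i : ℕ) (l : List ℕ)
    (g : ⋀[k]^i V →ₗ[k] WordTensor k V l →ₗ[k] N) (a : ⋀[k]^i V) (x : WordTensor k V l) :
    uncons i l g (cons i l a x) = g a x := by
  have : (uncons i l g) ∘ₗ (cons i l a) = g a := by
    refine PiTensorProduct.ext ?_
    ext y
    simp only [LinearMap.compMultilinearMap_apply, LinearMap.comp_apply]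
    rw [cons_tprod]
    simp only [uncons]
    erw [PiTensorProduct.lift.tprod]
    rfl
  exact LinearMap.congr_fun this x

end Terms

/-! ### The map `δ` on a single exterior power -/

section Coproduct

/-- The sign `s(A, B)`: the parity of the number of pairs `(a, b) ∈ A × B` with `b < a`,
so that `v_{A ∪ B} = s(A, B) v_A ∧ v_B` for disjoint `A`, `B`. -/
def shuffleSign {i : ℕ} (A B : Finset (Fin i)) : ℤ :=
  (-1) ^ ((A ×ˢ B).filter fun x => x.2 < x.1).card

variable {k V : Type*} [CommRing k] [AddCommGroup V] [Module k V]

/-- `v_A = v_{a₁} ∧ ⋯ ∧ v_{a_j}` for `A = {a₁ < ⋯ < a_j}`. -/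
def wedge {i : ℕ} (v : Fin i → V) (A : Finset (Fin i)) : ⋀[k]^A.card V :=
  exteriorPower.ιMulti k A.card fun j => v (A.orderEmbOfFin rfl j)

variable (k V) in
/-- The direct sum of `⋀^a V ⊗ ⋀^b V` over `a, b ≥ 1` with `a + b = i`. -/
abbrev TwoParts (i : ℕ) : Type _ :=
  ⨁ c : {c : ℕ × ℕ // 1 ≤ c.1 ∧ 1 ≤ c.2 ∧ c.1 + c.2 = i}, ⋀[k]^c.1.1 V ⊗[k] ⋀[k]^c.1.2 V

instance (i : ℕ) : AddCommGroup (TwoParts k V i) := Module.addCommMonoidToAddCommGroup k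

/-- The inclusion of `⋀^a V ⊗ ⋀^b V`. -/
def inclTwo {i : ℕ} (a b : ℕ) (h : 1 ≤ a ∧ 1 ≤ b ∧ a + b = i) :
    ⋀[k]^a V ⊗[k] ⋀[k]^b V →ₗ[k] TwoParts k V i :=
  DirectSum.lof k {c : ℕ × ℕ // 1 ≤ c.1 ∧ 1 ≤ c.2 ∧ c.1 + c.2 = i}
    (fun c => ⋀[k]^c.1.1 V ⊗[k] ⋀[k]^c.1.2 V) ⟨(a, b), h⟩

theorem card_split {i : ℕ} (A : {A : Finset (Fin i) // A.Nonempty ∧ Aᶜ.Nonempty}) :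
    1 ≤ A.1.card ∧ 1 ≤ A.1ᶜ.card ∧ A.1.card + A.1ᶜ.card = i :=
  ⟨A.2.1.card_pos, A.2.2.card_pos, by rw [Finset.card_add_card_compl, Fintype.card_fin]⟩

/-- `∑_{A, B} s(A, B) v_A ⊗ v_B`, over all decompositions of `{1, …, i}` into disjoint nonempty
subsets `A` and `B = Aᶜ`. -/
def shuffleSum {i : ℕ} (v : Fin i → V) : TwoParts k V i :=
  ∑ A : {A : Finset (Fin i) // A.Nonempty ∧ Aᶜ.Nonempty},
    shuffleSign A.1 A.1ᶜ •
      inclTwo A.1.card A.1ᶜ.card (card_split A) (wedge v A.1 ⊗ₜ[k] wedge v A.1ᶜ)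

theorem wedge_update_of_mem {i : ℕ} {A : Finset (Fin i)} {m : Fin i} (hm : m ∈ A) :
    ∃ j : Fin A.card, ∀ (v : Fin i → V) (x : V), wedge (k := k) (Function.update v m x) A =
      exteriorPower.ιMulti k A.card (Function.update (fun j => v (A.orderEmbOfFin rfl j)) j x) := by
  have hm' : m ∈ Set.range (A.orderEmbOfFin rfl) := by
    rw [Finset.range_orderEmbOfFin]; exact hm
  obtain ⟨j, hj⟩ := hm'
  refine ⟨j, fun v x => ?_⟩
  unfold wedge
  congr 1
  funext j'
  by_cases h : j' = j
  · subst h; simp [hj]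
  · rw [Function.update_of_ne h, Function.update_of_ne]
    rw [← hj]
    exact fun h' => h ((A.orderEmbOfFin rfl).injective h')

theorem wedge_update_of_notMem {i : ℕ} {A : Finset (Fin i)} {m : Fin i} (hm : m ∉ A)
    (v : Fin i → V) (x : V) : wedge (k := k) (Function.update v m x) A = wedge v A := by
  unfold wedge
  congr 1
  funext j'
  rw [Function.update_of_ne]
  intro h
  exact hm (h ▸ A.orderEmbOfFin_mem rfl j')

theorem wedge_eq_zero {i : ℕ} {A : Finset (Fin i)} {p q : Fin i} (hp : p ∈ A) (hq : q ∈ A)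
    (hpq : p ≠ q) (v : Fin i → V) (hv : v p = v q) : wedge (k := k) v A = 0 := by
  have hp' : p ∈ Set.range (A.orderEmbOfFin rfl) := by
    rw [Finset.range_orderEmbOfFin]; exact hp
  have hq' : q ∈ Set.range (A.orderEmbOfFin rfl) := by
    rw [Finset.range_orderEmbOfFin]; exact hq
  obtain ⟨a, rfl⟩ := hp'
  obtain ⟨b, rfl⟩ := hq'
  exact AlternatingMap.map_eq_zero_of_eq _ _ hv fun h => hpq (by rw [h])

/-- `shuffleSum` as a multilinear map. -/
def shuffleMultilinear (i : ℕ) : MultilinearMap k (fun _ : Fin i => V) (TwoParts k V i) :=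
  MultilinearMap.mk' shuffleSum
    (fun v m x y => by
      unfold shuffleSum
      rw [← Finset.sum_add_distrib]
      refine Finset.sum_congr rfl fun A _ => ?_
      rw [← smul_add, ← map_add]
      congr 2
      by_cases h : m ∈ A.1
      · obtain ⟨j, hj⟩ := wedge_update_of_mem (k := k) (V := V) h
        have h' : m ∉ A.1ᶜ := by simpa using h
        simp only [hj, wedge_update_of_notMem h', AlternatingMap.map_update_add,
          TensorProduct.add_tmul]
      · have h' : m ∈ A.1ᶜ := by simpa using h
        obtain ⟨j, hj⟩ := wedge_update_of_mem (k := k) (V := V) h'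
        simp only [hj, wedge_update_of_notMem h, AlternatingMap.map_update_add,
          TensorProduct.tmul_add])
    (fun v m c x => by
      unfold shuffleSum
      rw [Finset.smul_sum]
      refine Finset.sum_congr rfl fun A _ => ?_
      rw [smul_comm c, ← LinearMap.map_smul]
      congr 2
      by_cases h : m ∈ A.1
      · obtain ⟨j, hj⟩ := wedge_update_of_mem (k := k) (V := V) h
        have h' : m ∉ A.1ᶜ := by simpa using h
        simp only [hj, wedge_update_of_notMem h', AlternatingMap.map_update_smul,
          TensorProduct.smul_tmul']
      · have h' : m ∈ A.1ᶜ := by simpa using h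
        obtain ⟨j, hj⟩ := wedge_update_of_mem (k := k) (V := V) h'
        simp only [hj, wedge_update_of_notMem h, AlternatingMap.map_update_smul,
          TensorProduct.tmul_smul])

/-- Exchanging two adjacent indices, the first in `A` and the second outside, changes the sign. -/
theorem shuffleSign_swap {i : ℕ} (p q : Fin i) (hpq : (p : ℕ) + 1 = q) (A : Finset (Fin i))
    (hp : p ∈ A) (hq : q ∉ A) :
    shuffleSign (A.map (Equiv.swap p q).toEmbedding) (A.map (Equiv.swap p q).toEmbedding)ᶜ =
      - shuffleSign A Aᶜ := by
  have hne : p ≠ q := by rintro rfl; omega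
  have key : ((A.map (Equiv.swap p q).toEmbedding) ×ˢ
        (A.map (Equiv.swap p q).toEmbedding)ᶜ).filter (fun x => x.2 < x.1) =
      insert (q, p) (((A ×ˢ Aᶜ).filter fun x => x.2 < x.1).map
        ((Equiv.swap p q).prodCongr (Equiv.swap p q)).toEmbedding) := by
    ext ⟨a, b⟩
    simp only [Finset.mem_filter, Finset.mem_product, Finset.mem_insert, Finset.mem_map_equiv,
      Finset.mem_compl, Equiv.symm_swap, Equiv.prodCongr_symm, Equiv.prodCongr_apply,
      Prod.map_apply, Prod.mk.injEq]
    simp only [Equiv.swap_apply_def, Fin.lt_def, Fin.ext_iff] at *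
    split_ifs <;> simp_all [Fin.ext_iff] <;> omega
  unfold shuffleSign
  rw [key, Finset.card_insert_of_notMem, Finset.card_map, pow_succ]
  · ring
  · simp only [Finset.mem_map_equiv, Finset.mem_filter, Finset.mem_product, Equiv.symm_swap,
      Equiv.prodCongr_symm, Equiv.prodCongr_apply, Prod.map_apply, Equiv.swap_apply_left,
      Equiv.swap_apply_right, Fin.lt_def]
    omega

theorem map_compl_swap {i : ℕ} (p q : Fin i) (A : Finset (Fin i)) :
    (A.map (Equiv.swap p q).toEmbedding)ᶜ = Aᶜ.map (Equiv.swap p q).toEmbedding := by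
  ext a
  simp [Finset.mem_map_equiv]

theorem map_map_swap {i : ℕ} (p q : Fin i) (A : Finset (Fin i)) :
    (A.map (Equiv.swap p q).toEmbedding).map (Equiv.swap p q).toEmbedding = A := by
  ext a
  simp [Finset.mem_map_equiv]

/-- `wedge` with the cardinality as a parameter. -/
theorem wedge_swap {i : ℕ} (p q : Fin i) (hpq : (p : ℕ) + 1 = q) (v : Fin i → V) (hv : v p = v q)
    (A : Finset (Fin i)) (hA : ¬ (p ∈ A ∧ q ∈ A)) (a : ℕ) (h₁ : A.card = a)
    (h₂ : (A.map (Equiv.swap p q).toEmbedding).card = a) :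
    exteriorPower.ιMulti k a (fun j => v ((A.map (Equiv.swap p q).toEmbedding).orderEmbOfFin h₂ j))
      = exteriorPower.ιMulti k a (fun j => v (A.orderEmbOfFin h₁ j)) := by
  have hvs : ∀ m, v (Equiv.swap p q m) = v m := by
    intro m
    rw [Equiv.swap_apply_def]
    split_ifs with h h' <;> simp_all
  have : (fun j => Equiv.swap p q (A.orderEmbOfFin h₁ j)) =
      (A.map (Equiv.swap p q).toEmbedding).orderEmbOfFin h₂ := by
    refine Finset.orderEmbOfFin_unique h₂ (fun j => ?_) ?_
    · simp [Finset.orderEmbOfFin_mem]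
    · intro x y hxy
      have h := (A.orderEmbOfFin h₁).strictMono hxy
      have hx := A.orderEmbOfFin_mem h₁ x
      have hy := A.orderEmbOfFin_mem h₁ y
      change Equiv.swap p q (A.orderEmbOfFin h₁ x) < Equiv.swap p q (A.orderEmbOfFin h₁ y)
      generalize A.orderEmbOfFin h₁ x = x' at *
      generalize A.orderEmbOfFin h₁ y = y' at *
      simp only [Equiv.swap_apply_def]
      have hpq' : ¬ ((x' = p ∧ y' = q)) := by rintro ⟨rfl, rfl⟩; exact hA ⟨hx, hy⟩
      clear hx hy
      split_ifs <;> simp only [Fin.lt_def, Fin.ext_iff] at * <;> omega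
  rw [← this]
  simp only [hvs]

theorem inclTwo_wedge {i : ℕ} (v : Fin i → V) (A B : Finset (Fin i)) (a b : ℕ) (hA : A.card = a)
    (hB : B.card = b) (h : 1 ≤ A.card ∧ 1 ≤ B.card ∧ A.card + B.card = i)
    (h' : 1 ≤ a ∧ 1 ≤ b ∧ a + b = i) :
    inclTwo A.card B.card h (wedge v A ⊗ₜ[k] wedge v B) =
      inclTwo a b h' (exteriorPower.ιMulti k a (fun j => v (A.orderEmbOfFin hA j)) ⊗ₜ[k]
        exteriorPower.ιMulti k b (fun j => v (B.orderEmbOfFin hB j))) := by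
  subst hA hB
  rfl

theorem inclTwo_wedge_swap {i : ℕ} (p q : Fin i) (hpq : (p : ℕ) + 1 = q) (v : Fin i → V)
    (hv : v p = v q) (A A' B B' : Finset (Fin i)) (hA' : A' = A.map (Equiv.swap p q).toEmbedding)
    (hB' : B' = B.map (Equiv.swap p q).toEmbedding)
    (hA : ¬ (p ∈ A ∧ q ∈ A)) (hB : ¬ (p ∈ B ∧ q ∈ B))
    (h : 1 ≤ A.card ∧ 1 ≤ B.card ∧ A.card + B.card = i)
    (h' : 1 ≤ A'.card ∧ 1 ≤ B'.card ∧ A'.card + B'.card = i) :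
    inclTwo A'.card B'.card h' (wedge v A' ⊗ₜ[k] wedge v B') =
      inclTwo A.card B.card h (wedge v A ⊗ₜ[k] wedge v B) := by
  subst hA' hB'
  rw [inclTwo_wedge v _ _ A.card B.card (Finset.card_map _) (Finset.card_map _) h' h,
    wedge_swap p q hpq v hv A hA _ rfl, wedge_swap p q hpq v hv B hB _ rfl]
  rfl

theorem shuffleSum_adjacent {i : ℕ} (p q : Fin i) (hpq : (p : ℕ) + 1 = q) (v : Fin i → V)
    (hv : v p = v q) : shuffleSum (k := k) v = 0 := by
  have hne : p ≠ q := by rintro rfl; omega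
  unfold shuffleSum
  refine Finset.sum_involution
    (fun A _ => ⟨A.1.map (Equiv.swap p q).toEmbedding, A.2.1.map, by
      rw [map_compl_swap]; exact A.2.2.map⟩) ?_ ?_ (fun _ _ => Finset.mem_univ _) ?_
  · intro A _
    by_cases h1 : p ∈ A.1 <;> by_cases h2 : q ∈ A.1
    · have e : A.1.map (Equiv.swap p q).toEmbedding = A.1 := by
        ext a
        simp only [Finset.mem_map_equiv, Equiv.symm_swap, Equiv.swap_apply_def]
        split_ifs <;> simp_all
      have e' : (⟨A.1.map (Equiv.swap p q).toEmbedding, A.2.1.map, by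
          rw [map_compl_swap]; exact A.2.2.map⟩ :
          {A : Finset (Fin i) // A.Nonempty ∧ Aᶜ.Nonempty}) = A := Subtype.ext e
      rw [e']
      simp only [wedge_eq_zero h1 h2 hne v hv, TensorProduct.zero_tmul, map_zero, smul_zero,
        add_zero]
    · rw [shuffleSign_swap p q hpq A.1 h1 h2,
        inclTwo_wedge_swap p q hpq v hv A.1 _ A.1ᶜ _ rfl (map_compl_swap p q A.1)
          (fun h => h2 h.2) (fun h => Finset.mem_compl.1 h.1 h1) (card_split A)]
      rw [neg_smul, add_neg_cancel]
    · have h3 : p ∈ A.1.map (Equiv.swap p q).toEmbedding := by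
        simpa [Finset.mem_map_equiv] using h2
      have h4 : q ∉ A.1.map (Equiv.swap p q).toEmbedding := by
        simpa [Finset.mem_map_equiv] using h1
      have h5 := shuffleSign_swap p q hpq _ h3 h4
      rw [map_map_swap] at h5
      rw [h5, inclTwo_wedge_swap p q hpq v hv A.1 _ A.1ᶜ _ rfl (map_compl_swap p q A.1)
          (fun h => h1 h.1) (fun h => Finset.mem_compl.1 h.2 h2) (card_split A)]
      rw [neg_smul, neg_add_cancel]
    · have e : A.1.map (Equiv.swap p q).toEmbedding = A.1 := by
        ext a
        simp only [Finset.mem_map_equiv, Equiv.symm_swap, Equiv.swap_apply_def]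
        split_ifs <;> simp_all
      have h1' : p ∈ A.1ᶜ := Finset.mem_compl.2 h1
      have h2' : q ∈ A.1ᶜ := Finset.mem_compl.2 h2
      have e' : (⟨A.1.map (Equiv.swap p q).toEmbedding, A.2.1.map, by
          rw [map_compl_swap]; exact A.2.2.map⟩ :
          {A : Finset (Fin i) // A.Nonempty ∧ Aᶜ.Nonempty}) = A := Subtype.ext e
      rw [e']
      simp only [wedge_eq_zero h1' h2' hne v hv, TensorProduct.tmul_zero, map_zero, smul_zero,
        add_zero]
  · intro A _ hA h
    apply hA
    have e : A.1.map (Equiv.swap p q).toEmbedding = A.1 := congrArg Subtype.val h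
    have e' : p ∈ A.1 ↔ q ∈ A.1 := by
      conv_lhs => rw [← e]
      simp [Finset.mem_map_equiv]
    by_cases h1 : p ∈ A.1
    · rw [wedge_eq_zero h1 (e'.1 h1) hne v hv]
      simp
    · have h1' : p ∈ A.1ᶜ := Finset.mem_compl.2 h1
      have h2' : q ∈ A.1ᶜ := Finset.mem_compl.2 fun h => h1 (e'.2 h)
      rw [wedge_eq_zero h1' h2' hne v hv]
      simp
  · intro A _
    exact Subtype.ext (map_map_swap p q A.1)

/-- A multilinear map that vanishes when two adjacent arguments are equal is alternating. -/
theorem eq_zero_of_adjacent {N : Type*} [AddCommGroup N] [Module k N] {i : ℕ}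
    (f : MultilinearMap k (fun _ : Fin i => V) N)
    (hf : ∀ (p q : Fin i), (p : ℕ) + 1 = q → ∀ v : Fin i → V, v p = v q → f v = 0)
    (v : Fin i → V) (p q : Fin i) (hv : v p = v q) (hpq : p ≠ q) : f v = 0 := by
  have hswap : ∀ (p q : Fin i), (p : ℕ) + 1 = q → ∀ v : Fin i → V,
      f v = 0 ↔ f (v ∘ Equiv.swap p q) = 0 := by
    intro p q h v
    have hne : p ≠ q := by rintro rfl; omega
    have h0 := hf p q h (Function.update (Function.update v p (v p + v q)) q (v p + v q))
      (by simp [hne])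
    have e1 : Function.update (Function.update v p (v p)) q (v q) = v := by simp
    have e2 : Function.update (Function.update v p (v q)) q (v p) = v ∘ Equiv.swap p q := by
      funext m
      simp only [Function.update_apply, Function.comp_apply, Equiv.swap_apply_def]
      split_ifs <;> simp_all
    have h1 := hf p q h (Function.update (Function.update v p (v p)) q (v p)) (by simp [hne])
    have h2 := hf p q h (Function.update (Function.update v p (v q)) q (v q)) (by simp [hne])
    have h3 : ∀ x, f (Function.update (Function.update v p (v p + v q)) q x) =
        f (Function.update (Function.update v p (v p)) q x) +
          f (Function.update (Function.update v p (v q)) q x) := by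
      intro x
      have c : ∀ y, Function.update (Function.update v p y) q x =
        Function.update (Function.update v q x) p y := fun y => Function.update_comm hne y x v
      rw [c, c, c, f.map_update_add]
    rw [f.map_update_add, h3, h3, h1, h2, e1, e2] at h0
    simp only [zero_add, add_zero] at h0
    constructor
    · intro h'; rw [h'] at h0; simpa using h0
    · intro h'; rw [h'] at h0; simpa using h0
  rcases i with _ | _ | n
  · exact p.elim0
  · exact absurd (Fin.ext (by omega)) hpq
  · have hperm : ∀ σ : Equiv.Perm (Fin (n + 2)), ∀ v : Fin (n + 2) → V,
        f v = 0 ↔ f (v ∘ σ) = 0 := by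
      intro σ
      have hσ : σ ∈ Submonoid.closure (Set.range fun j : Fin (n + 1) =>
          Equiv.swap j.castSucc j.succ) := by
        rw [Equiv.Perm.mclosure_swap_castSucc_succ]; trivial
      induction hσ using Submonoid.closure_induction with
      | mem x hx =>
        obtain ⟨j, rfl⟩ := hx
        exact hswap _ _ (by simp)
      | one => intro v; rfl
      | mul x y _ _ hx hy =>
        intro v
        rw [hx v, hy (v ∘ x)]
        rfl
    obtain ⟨σ, h0, h1⟩ : ∃ σ : Equiv.Perm (Fin (n + 2)), σ 0 = p ∧ σ 1 = q := by
      refine ⟨Equiv.swap 0 p * Equiv.swap 1 (Equiv.swap 0 p q), ?_, ?_⟩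
      · rw [Equiv.Perm.mul_apply, Equiv.swap_apply_of_ne_of_ne (a := (1 : Fin (n + 2))),
          Equiv.swap_apply_left]
        · simp
        · intro h
          apply hpq
          have := congrArg (Equiv.swap 0 p) h
          simpa using this
      · simp
    rw [hperm σ v]
    exact hf 0 1 (by simp) _ (by simp [h0, h1, hv])

/-- `shuffleSum` as an alternating map. -/
def shuffleAlternating (i : ℕ) : V [⋀^Fin i]→ₗ[k] TwoParts k V i :=
  { shuffleMultilinear i with
    map_eq_zero_of_eq' := fun v p q hv hpq =>
      eq_zero_of_adjacent (shuffleMultilinear i)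
        (fun p q h v hv => shuffleSum_adjacent p q h v hv) v p q hv hpq }

/-- `δ(v₁ ∧ ⋯ ∧ v_i) = ∑_{A, B} s(A, B) v_A ⊗ v_B`, as a linear map on `⋀^i V`. -/
def deltaOne (i : ℕ) : ⋀[k]^i V →ₗ[k] TwoParts k V i :=
  exteriorPower.alternatingMapLinearEquiv (shuffleAlternating i)

theorem deltaOne_ιMulti {i : ℕ} (v : Fin i → V) :
    deltaOne i (exteriorPower.ιMulti k i v) =
      ∑ A : {A : Finset (Fin i) // A.Nonempty ∧ Aᶜ.Nonempty},
        shuffleSign A.1 A.1ᶜ •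
          inclTwo A.1.card A.1ᶜ.card (card_split A) (wedge v A.1 ⊗ₜ[k] wedge v A.1ᶜ) :=
  exteriorPower.alternatingMapLinearEquiv_apply_ιMulti _ _

end Coproduct

/-! ### The differentials -/

section Differentials

variable {k V : Type*} [CommRing k] [AddCommGroup V] [Module k V]

theorem IsComposition.cons_cons {t p i : ℕ} {l : List ℕ} (h : IsComposition t p (i :: l))
    {a b : ℕ} (hab : 1 ≤ a ∧ 1 ≤ b ∧ a + b = i) : IsComposition t (p + 1) (a :: b :: l) := by
  obtain ⟨h1, h2, h3⟩ := h
  simp only [IsComposition, List.mem_cons, forall_eq_or_imp, List.sum_cons, List.length_cons] at *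
  refine ⟨⟨hab.1, hab.2.1, h1.2⟩, ?_, ?_⟩ <;> omega

theorem IsComposition.tail {t p i : ℕ} {l : List ℕ} (h : IsComposition t p (i :: l)) :
    IsComposition l.sum l.length l :=
  ⟨fun j hj => h.1 j (List.mem_cons_of_mem i hj), rfl, rfl⟩

theorem IsComposition.cons {t p i : ℕ} {l l' : List ℕ} (h : IsComposition t p (i :: l))
    (h' : IsComposition l.sum (l.length + 1) l') : IsComposition t (p + 1) (i :: l') := by
  obtain ⟨h1, h2, h3⟩ := h
  obtain ⟨h1', h2', h3'⟩ := h'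
  simp only [IsComposition, List.mem_cons, forall_eq_or_imp, List.sum_cons, List.length_cons] at *
  refine ⟨⟨h1.1, h1'⟩, ?_, ?_⟩ <;> omega

/-- `γ ↦ β ↦ γ ⊗ β` for `γ ∈ ⨁ ⋀^a V ⊗ ⋀^b V` (the sum over `a + b = i`) and
`β ∈ ⋀^{i₂} V ⊗ ⋯ ⊗ ⋀^{i_p} V`, where `(i, i₂, …, i_p)` is a composition of `t`. -/
def twoTensor {t p i : ℕ} {l : List ℕ} (h : IsComposition t p (i :: l)) :
    TwoParts k V i →ₗ[k] WordTensor k V l →ₗ[k] T k V t (p + 1) :=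
  DirectSum.toModule k _ _ fun c =>
    TensorProduct.lift <| LinearMap.mk₂ k
      (fun x y => incl (c.1.1 :: c.1.2 :: l) (h.cons_cons c.2) ∘ₗ
        cons c.1.1 (c.1.2 :: l) x ∘ₗ cons c.1.2 l y)
      (fun x x' y => by ext; simp) (fun r x y => by ext; simp)
      (fun x y y' => by ext; simp) (fun r x y => by ext; simp)

/-- `α ↦ γ ↦ α ⊗ γ` for `α ∈ ⋀^i V` and `γ ∈ T_{t-i}^p`, where `(i, i₂, …, i_p)` is a
composition of `t`; the result lies in `T_t^{p+1}`. -/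
def oneTensor {t p i : ℕ} {l : List ℕ} (h : IsComposition t p (i :: l)) :
    ⋀[k]^i V →ₗ[k] T k V l.sum (l.length + 1) →ₗ[k] T k V t (p + 1) :=
  LinearMap.flip <| DirectSum.toModule k _ _ fun c =>
    LinearMap.flip <| (cons i c.1).compr₂ (incl (i :: c.1) (h.cons c.2))

/-- `δ` on the direct summand `⋀^{i₁} V ⊗ ⋯ ⊗ ⋀^{i_p} V` of `T_t^p`: the graded Leibniz rule
`δ(α ⊗ β) = δ(α) ⊗ β - α ⊗ δ(β)` with `α ∈ ⋀^{i₁} V` and `β ∈ ⋀^{i₂} V ⊗ ⋯ ⊗ ⋀^{i_p} V`. -/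
def deltaWord : (l : List ℕ) → (t p : ℕ) → IsComposition t p l →
    WordTensor k V l →ₗ[k] T k V t (p + 1)
  | [], _, _, _ => 0
  | i :: l, _, _, h =>
    uncons i l
      (twoTensor h ∘ₗ deltaOne i -
        (oneTensor h).compl₂ (deltaWord l l.sum l.length h.tail))

theorem deltaWord_cons {t p i : ℕ} {l : List ℕ} (h : IsComposition t p (i :: l))
    (α : ⋀[k]^i V) (β : WordTensor k V l) :
    deltaWord (i :: l) t p h (cons i l α β) =
      twoTensor h (deltaOne i α) β -
        oneTensor h α (deltaWord l l.sum l.length h.tail β) := by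
  rw [deltaWord, uncons_cons]
  rfl

theorem twoTensor_inclTwo {t p i a b : ℕ} {l : List ℕ} (h : IsComposition t p (i :: l))
    (hab : 1 ≤ a ∧ 1 ≤ b ∧ a + b = i) (α : ⋀[k]^a V) (β : ⋀[k]^b V) (x : WordTensor k V l) :
    twoTensor h (inclTwo a b hab (α ⊗ₜ[k] β)) x =
      incl (a :: b :: l) (h.cons_cons hab) (cons a (b :: l) α (cons b l β x)) := by
  unfold twoTensor inclTwo
  erw [DirectSum.toModule_lof]
  rfl

theorem oneTensor_incl {t p i : ℕ} {l l' : List ℕ} (h : IsComposition t p (i :: l))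
    (h' : IsComposition l.sum (l.length + 1) l') (α : ⋀[k]^i V) (x : WordTensor k V l') :
    oneTensor h α (incl l' h' x) = incl (i :: l') (h.cons h') (cons i l' α x) := by
  unfold oneTensor
  rw [LinearMap.flip_apply, incl, DirectSum.toModule_lof]
  rfl

variable (k V) in
/-- The differential `δ : T_t^p → T_t^{p+1}`. -/
def delta (t p : ℕ) : T k V t p →ₗ[k] T k V t (p + 1) :=
  DirectSum.toModule k _ _ fun c => deltaWord c.1 t p c.2

/-- The identification `⋀^1 V = V`, followed by `V → S^1 V`. It is extended by zero to `⋀^i V`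
for `i ≠ 1`; only `i = 1` occurs in `T_t^t`. -/
def toSym : (i : ℕ) → ⋀[k]^i V →ₗ[k] SymmetricAlgebra k V
  | 1 => exteriorPower.alternatingMapLinearEquiv
      (AlternatingMap.ofSubsingleton k V (SymmetricAlgebra k V) 0 (SymmetricAlgebra.ι k V))
  | _ => 0

/-- `v₁ ⊗ ⋯ ⊗ v_p ↦ v₁ ⋯ v_p`. -/
def piWord (l : List ℕ) : WordTensor k V l →ₗ[k] SymmetricAlgebra k V :=
  PiTensorProduct.lift
    ((MultilinearMap.mkPiAlgebra k (Fin l.length) (SymmetricAlgebra k V)).compLinearMap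
      fun j => toSym (l.get j))

theorem toSym_mem (i : ℕ) (α : ⋀[k]^i V) :
    toSym i α ∈ LinearMap.range (SymmetricAlgebra.ι k V) := by
  unfold toSym
  split
  · have h : (⊤ : Submodule k (⋀[k]^1 V)) ≤
        (LinearMap.range (SymmetricAlgebra.ι k V)).comap
          (exteriorPower.alternatingMapLinearEquiv
            (AlternatingMap.ofSubsingleton k V (SymmetricAlgebra k V) (0 : Fin 1)
              (SymmetricAlgebra.ι k V))) := by
      rw [← exteriorPower.ιMulti_span, Submodule.span_le]
      rintro _ ⟨v, rfl⟩
      simp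
    exact h (Submodule.mem_top (x := α))
  · simp

theorem piWord_mem (l : List ℕ) (x : WordTensor k V l) :
    piWord l x ∈ SymPower k V l.length := by
  induction x using PiTensorProduct.induction_on with
  | smul_tprod r f =>
    rw [map_smul]
    refine Submodule.smul_mem _ _ ?_
    simp only [piWord, PiTensorProduct.lift.tprod, MultilinearMap.compLinearMap_apply,
      MultilinearMap.mkPiAlgebra_apply]
    have h : ∀ s : Finset (Fin l.length), ∏ j ∈ s, toSym (l.get j) (f j) ∈
        LinearMap.range (SymmetricAlgebra.ι k V) ^ s.card := by
      intro s
      induction s using Finset.induction_on with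
      | empty => simp
      | insert a s ha ih =>
        rw [Finset.prod_insert ha, Finset.card_insert_of_notMem ha, pow_succ']
        exact Submodule.mul_mem_mul (toSym_mem _ _) ih
    simpa using h Finset.univ
  | add x y hx hy => rw [map_add]; exact Submodule.add_mem _ hx hy

variable (k V) in
/-- The natural projection `π : T_t^t = V^{⊗ t} → S^t V`, written as a map on `T_t^p` for
`p = t`. The only composition of `t` into `t` parts is `(1, …, 1)`. -/
def proj {t p : ℕ} (h : p = t) : T k V t p →ₗ[k] SymPower k V t :=
  DirectSum.toModule k _ _ fun c =>
    (piWord c.1).codRestrict (SymPower k V t) fun x =>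
      (congrArg (fun n => piWord c.1 x ∈ SymPower k V n) (c.2.2.2.trans h)).mp (piWord_mem c.1 x)

end Differentials

end KoszulInversion

end

/-!
The complex is the degree `t` part of the reduced cobar complex of the exterior coalgebra, and
exactness says that this coalgebra is Koszul with dual algebra the symmetric algebra. The proof is
a filtration argument with an explicit contracting homotopy; it works over every commutative ring
for which `V` has a basis.

Fix a basis of `V` indexed by a linearly ordered type `ι`. Then `T_t^p` has a basis of words
`(A₁, …, A_p)` of nonempty finite subsets of `ι` with sizes adding up to `t`, and `δ` is the signed
sum over all ways to split a letter `A_j = B ⊔ C` into two letters `B`, `C`. The weight of a word is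
its number of inversions, the pairs `x ∈ A_i`, `y ∈ A_j` with `i < j` and `y < x`. Splitting `B ⊔ C`
raises the weight by the number of inversions between `B` and `C`; hence `δ` does not lower the
weight, and its weight-preserving part `δ₀` consists of the splittings with `B` entirely below `C`,
all of which have sign `1` in `δ`. If letters are written as increasing sequences, `δ₀` keeps their
concatenation and only inserts a bar at an ascent. Merging at the first ascent gives a map `h` of
weight `0` such that `h δ₀ + δ₀ h` is the identity on all words except the standard ones,
`({a₁}, …, {a_p})` with `a₁ ≥ ⋯ ≥ a_p`, which it kills (`lowest_homotopy`). Consequently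
`x - δ (h x)` is, for a cycle `x`, a combination of standard words and of words of higher weight
than those in `x` (`homotopy_mem`). The weight is at most `t ^ 2`, so iteration shows that every
cycle is homologous to a combination of standard words
(`exists_sub_wordDelta_mem_standardSpan`).

For `p < t` there are no standard words in `T_t^p`. For `p = t` the projection `π` maps them to
distinct monomials in the symmetric algebra (`eq_zero_of_mem_standardSpan`), so the boundaries are
the whole kernel of `π`.
-/

noncomputable section

namespace KoszulInversion

/-! ### Words of finite sets and their weight -/

section Words

variable {ι : Type*} [LinearOrder ι]

/-- The number of pairs `(a, b) ∈ A × B` with `b < a`. -/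
def inversions (A B : Finset ι) : ℕ :=
  ((A ×ˢ B).filter fun x => x.2 < x.1).card

theorem inversions_union_left {A B : Finset ι} (h : Disjoint A B) (C : Finset ι) :
    inversions (A ∪ B) C = inversions A C + inversions B C := by
  unfold inversions
  rw [Finset.union_product, Finset.filter_union, Finset.card_union_of_disjoint]
  exact Finset.disjoint_filter_filter (Finset.disjoint_product.2 (Or.inl h))

theorem inversions_union_right (C : Finset ι) {A B : Finset ι} (h : Disjoint A B) :
    inversions C (A ∪ B) = inversions C A + inversions C B := by
  unfold inversions
  rw [Finset.product_union, Finset.filter_union, Finset.card_union_of_disjoint]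
  exact Finset.disjoint_filter_filter (Finset.disjoint_product.2 (Or.inr h))

theorem inversions_le (A B : Finset ι) : inversions A B ≤ A.card * B.card :=
  (Finset.card_filter_le _ _).trans (Finset.card_product A B).le

/-- Every element of `A` is smaller than every element of `B`. -/
abbrev Below (A B : Finset ι) : Prop := ∀ a ∈ A, ∀ b ∈ B, a < b

theorem Below.inversions_eq_zero {A B : Finset ι} (h : Below A B) : inversions A B = 0 := by
  unfold inversions
  rw [Finset.card_eq_zero, Finset.filter_eq_empty_iff]
  rintro ⟨a, b⟩ hab
  exact (h a (Finset.mem_product.1 hab).1 b (Finset.mem_product.1 hab).2).not_gt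

theorem Below.disjoint {A B : Finset ι} (h : Below A B) : Disjoint A B :=
  Finset.disjoint_left.2 fun a ha hb => (h a ha a hb).false

theorem inversions_pos {A B : Finset ι} (hd : Disjoint A B) (h : ¬ Below A B) :
    1 ≤ inversions A B := by
  simp only [Below, not_forall, not_lt] at h
  obtain ⟨a, ha, b, hb, hab⟩ := h
  refine Finset.card_pos.2 ⟨(a, b), ?_⟩
  simp only [Finset.mem_filter, Finset.mem_product]
  exact ⟨⟨ha, hb⟩, hab.lt_of_ne (by rintro rfl; exact Finset.disjoint_left.1 hd ha hb)⟩

/-- The number of inversions of a word of finite sets, counted between different letters. If every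
letter is written as an increasing sequence, this is the number of inversions of the
concatenation. -/
def weight : List (Finset ι) → ℕ
  | [] => 0
  | A :: l => (l.map (inversions A)).sum + weight l

theorem weight_le (L : List (Finset ι)) : weight L ≤ (L.map Finset.card).sum ^ 2 := by
  induction L with
  | nil => simp [weight]
  | cons A l ih =>
    have h : (l.map (inversions A)).sum ≤ A.card * (l.map Finset.card).sum := by
      rw [← List.sum_map_mul_left]
      exact List.sum_le_sum fun B _ => inversions_le A B
    simp only [weight, List.map_cons, List.sum_cons]
    nlinarith [Nat.zero_le A.card, Nat.zero_le (l.map Finset.card).sum]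

/-- `SplitsTo L L' q`: the word `L'` arises from `L` by replacing one letter `B ∪ C` by two letters
`B`, `C`, where `B`, `C` are disjoint and nonempty with `q` inversions between them. -/
inductive SplitsTo : List (Finset ι) → List (Finset ι) → ℕ → Prop
  | head (B C : Finset ι) (l : List (Finset ι)) (hd : Disjoint B C) (hB : B.Nonempty)
      (hC : C.Nonempty) : SplitsTo ((B ∪ C) :: l) (B :: C :: l) (inversions B C)
  | tail (A : Finset ι) {l l' : List (Finset ι)} {q : ℕ} (h : SplitsTo l l' q) :
      SplitsTo (A :: l) (A :: l') q

namespace SplitsTo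

theorem sum_map {L L' : List (Finset ι)} {q : ℕ} (h : SplitsTo L L' q) (f : Finset ι → ℕ)
    (hf : ∀ B C, Disjoint B C → f (B ∪ C) = f B + f C) : (L'.map f).sum = (L.map f).sum := by
  induction h with
  | head B C l hd _ _ => simp [hf B C hd, add_assoc]
  | tail A _ ih => simp [ih]

/-- Inversions with the other letters are unchanged when a letter is split. -/
theorem weight_eq {L L' : List (Finset ι)} {q : ℕ} (h : SplitsTo L L' q) :
    weight L' = weight L + q := by
  induction h with
  | head B C l hd _ _ =>
    have : (l.map (inversions (B ∪ C))).sum =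
        (l.map (inversions B)).sum + (l.map (inversions C)).sum := by
      rw [← List.sum_map_add]
      exact congrArg List.sum (List.map_congr_left fun D _ => inversions_union_left hd D)
    simp only [weight, List.map_cons, List.sum_cons, this]
    ring
  | tail A h ih =>
    simp only [weight, h.sum_map (inversions A) fun B C h => inversions_union_right A h, ih]
    ring

theorem length_eq {L L' : List (Finset ι)} {q : ℕ} (h : SplitsTo L L' q) :
    L'.length = L.length + 1 := by
  induction h with
  | head => simp
  | tail _ _ ih => simp [ih]

theorem forall_card_pos {L L' : List (Finset ι)} {q : ℕ} (h : SplitsTo L L' q) :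
    (∀ A ∈ L', 1 ≤ A.card) ↔ ∀ A ∈ L, 1 ≤ A.card := by
  induction h with
  | head B C l _ hB hC =>
    have hBC : (B ∪ C).Nonempty := hB.mono Finset.subset_union_left
    have hB' := hB.card_pos
    have hC' := hC.card_pos
    have hBC' := hBC.card_pos
    simp only [List.forall_mem_cons]
    exact ⟨fun h => ⟨hBC', h.2.2⟩, fun h => ⟨hB', hC', h.2⟩⟩
  | tail _ _ ih => simp only [List.forall_mem_cons, ih]

theorem isComposition_iff {L L' : List (Finset ι)} {q : ℕ} (h : SplitsTo L L' q) (t p : ℕ) :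
    IsComposition t (p + 1) (L'.map Finset.card) ↔ IsComposition t p (L.map Finset.card) := by
  simp only [IsComposition, List.forall_mem_map, h.forall_card_pos,
    h.sum_map _ fun _ _ => Finset.card_union_of_disjoint, List.length_map, h.length_eq,
    add_left_inj]

end SplitsTo

/-- Standard words are those of the form `({a₁}, …, {a_p})` with `a₁ ≥ ⋯ ≥ a_p`; they have no ascent
and correspond to the monomials of degree `p`. -/
def IsStandard (L : List (Finset ι)) : Prop :=
  ∃ w : List ι, w.Pairwise (· ≥ ·) ∧ L = w.map fun a => {a}

/-- The nonempty proper subsets of `A`. -/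
def splits (A : Finset ι) : Finset (Finset ι) := A.ssubsets.erase ∅

theorem mem_splits {A B : Finset ι} :
    B ∈ splits A ↔ B.Nonempty ∧ (A \ B).Nonempty ∧ B ⊆ A := by
  simp only [splits, Finset.mem_erase, Finset.mem_ssubsets, Finset.ssubset_iff_subset_ne,
    Finset.nonempty_iff_ne_empty, ne_eq, Finset.sdiff_eq_empty_iff_subset]
  constructor
  · rintro ⟨h, h1, h2⟩
    exact ⟨h, fun h3 => h2 (h1.antisymm h3), h1⟩
  · rintro ⟨h, h1, h2⟩
    exact ⟨h, h2, fun h3 => h1 h3.ge⟩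

theorem splits_singleton (a : ι) : splits {a} = ∅ := by
  ext B
  simp only [mem_splits, Finset.notMem_empty, iff_false, not_and, Finset.subset_singleton_iff]
  rintro h1 h2 (rfl | rfl)
  · simp at h1
  · simp at h2

end Words

/-! ### Operators on the free module on words -/

section Operators

variable {k : Type*} [CommRing k] {ι : Type*}

variable (k ι) in
/-- The free module on the words of finite subsets of `ι`. If `ι` indexes a basis of `V`, the words
with nonempty letters form a basis of the direct sum of all `T_t^p`. -/
abbrev WordModule : Type _ := List (Finset ι) →₀ k

/-- Prepending the letter `A`. -/
def prepend (A : Finset ι) : WordModule k ι →ₗ[k] WordModule k ι :=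
  Finsupp.lmapDomain k k (A :: ·)

@[simp]
theorem prepend_single (A : Finset ι) (L : List (Finset ι)) (r : k) :
    prepend A (Finsupp.single L r) = Finsupp.single (A :: L) r := by
  simp [prepend, Finsupp.mapDomain_single]

/-- `prepend` as a map between spans of words. -/
theorem prepend_mem_supported (A : Finset ι) {s s' : Set (List (Finset ι))}
    (h : ∀ L ∈ s, A :: L ∈ s') {x : WordModule k ι} (hx : x ∈ Finsupp.supported k k s) :
    prepend A x ∈ Finsupp.supported k k s' := by
  rw [Finsupp.supported_eq_span_single] at hx
  induction hx using Submodule.span_induction with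
  | mem x hx =>
    obtain ⟨L, hL, rfl⟩ := hx
    simp only [prepend_single]
    exact Finsupp.single_mem_supported k _ (h L hL)
  | zero => simp
  | add x y _ _ hx hy => rw [map_add]; exact add_mem hx hy
  | smul r x _ hx => rw [map_smul]; exact Submodule.smul_mem _ r hx

theorem mem_of_forall_single {s : Set (List (Finset ι))} {M : Submodule k (WordModule k ι)}
    (f : WordModule k ι →ₗ[k] WordModule k ι) (h : ∀ L ∈ s, f (Finsupp.single L 1) ∈ M)
    {x : WordModule k ι} (hx : x ∈ Finsupp.supported k k s) : f x ∈ M := by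
  have : Finsupp.supported k k s ≤ M.comap f := by
    rw [Finsupp.supported_eq_span_single, Submodule.span_le]
    rintro _ ⟨L, hL, rfl⟩
    exact h L hL
  exact this hx

variable [LinearOrder ι]

/-- The sum of `c(B, C)` times the word `B, C`, put in front, over all decompositions of `A` into
disjoint nonempty sets `B`, `C`. -/
def splitLetter (c : Finset ι → Finset ι → k) (A : Finset ι) :
    WordModule k ι →ₗ[k] WordModule k ι :=
  ∑ B ∈ splits A, c B (A \ B) • prepend B ∘ₗ prepend (A \ B)

theorem splitLetter_apply (c : Finset ι → Finset ι → k) (A : Finset ι) (x : WordModule k ι) :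
    splitLetter c A x = ∑ B ∈ splits A, c B (A \ B) • prepend B (prepend (A \ B) x) := by
  simp [splitLetter, LinearMap.sum_apply]

/-- The differential `wordDelta` on a word. -/
def wordDeltaAux (c : Finset ι → Finset ι → k) : List (Finset ι) → WordModule k ι
  | [] => 0
  | A :: l => splitLetter c A (Finsupp.single l 1) - prepend A (wordDeltaAux c l)

/-- The map which sends a word to the alternating sum over its letters `A` of all words in which
`A` is replaced by two letters `B`, `C` with `A = B ⊔ C`, weighted with `c(B, C)`. -/
def wordDelta (c : Finset ι → Finset ι → k) : WordModule k ι →ₗ[k] WordModule k ι :=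
  Finsupp.linearCombination k (wordDeltaAux c)

@[simp]
theorem wordDelta_single (c : Finset ι → Finset ι → k) (L : List (Finset ι)) :
    wordDelta c (Finsupp.single L 1) = wordDeltaAux c L := by
  simp [wordDelta]

theorem wordDelta_prepend (c : Finset ι → Finset ι → k) (A : Finset ι) (x : WordModule k ι) :
    wordDelta c (prepend A x) = splitLetter c A x - prepend A (wordDelta c x) := by
  induction x using Finsupp.induction_linear with
  | zero => simp
  | add x y hx hy => simp only [map_add, hx, hy]; abel
  | single L r =>
    have h : (Finsupp.single L r : WordModule k ι) = r • Finsupp.single L 1 := by simp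
    rw [h]
    simp only [map_smul, prepend_single, wordDelta_single, ← smul_sub]
    rfl

theorem wordDelta_sub (c c' : Finset ι → Finset ι → k) :
    wordDelta c - wordDelta c' = wordDelta fun B C => c B C - c' B C := by
  refine Finsupp.lhom_ext' fun L => LinearMap.ext_ring ?_
  simp only [LinearMap.comp_apply, LinearMap.sub_apply, Finsupp.lsingle_apply, wordDelta_single]
  induction L with
  | nil => simp [wordDeltaAux]
  | cons A l ih =>
    simp only [wordDeltaAux, splitLetter_apply, ← ih, sub_smul, Finset.sum_sub_distrib, map_sub]
    abel

/-- The words in the differential arise by splitting one letter. Only splittings with nonzero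
coefficient matter, so the bound `q` on their inversions is inherited. -/
theorem wordDeltaAux_mem (c : Finset ι → Finset ι → k) (q : ℕ)
    (hc : ∀ B C, Disjoint B C → c B C ≠ 0 → q ≤ inversions B C) (L : List (Finset ι)) :
    wordDeltaAux c L ∈ Finsupp.supported k k {L' | ∃ r, q ≤ r ∧ SplitsTo L L' r} := by
  induction L with
  | nil => exact zero_mem _
  | cons A l ih =>
    refine sub_mem ?_ (prepend_mem_supported A ?_ ih)
    · rw [splitLetter_apply]
      refine sum_mem fun B hB => ?_
      obtain ⟨h1, h2, h3⟩ := mem_splits.1 hB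
      by_cases h0 : c B (A \ B) = 0
      · rw [h0, zero_smul]; exact zero_mem _
      · refine Submodule.smul_mem _ _ ?_
        simp only [prepend_single]
        refine Finsupp.single_mem_supported k _ ⟨_, hc _ _ Finset.disjoint_sdiff h0, ?_⟩
        have := SplitsTo.head B (A \ B) l Finset.disjoint_sdiff h1 h2
        rwa [Finset.union_sdiff_of_subset h3] at this
    · rintro L' ⟨r, hr, h⟩
      exact ⟨r, hr, h.tail A⟩

variable (k ι) in
/-- The span of the words which encode basis elements of `T_t^p` and have weight at least `m`. -/
def wordFiltration (t p m : ℕ) :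
    Submodule k (WordModule k ι) :=
  Finsupp.supported k k {L | IsComposition t p (L.map Finset.card) ∧ m ≤ weight L}

theorem wordDelta_mem (c : Finset ι → Finset ι → k) (q : ℕ)
    (hc : ∀ B C, Disjoint B C → c B C ≠ 0 → q ≤ inversions B C) {t p m : ℕ}
    {x : WordModule k ι} (hx : x ∈ wordFiltration k ι t p m) :
    wordDelta c x ∈ wordFiltration k ι t (p + 1) (m + q) := by
  refine mem_of_forall_single _ ?_ hx
  rintro L ⟨hL, hm⟩
  rw [wordDelta_single]
  refine Finsupp.supported_mono ?_ (wordDeltaAux_mem c q hc L)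
  rintro L' ⟨r, hr, h⟩
  exact ⟨(h.isComposition_iff t p).2 hL, by rw [h.weight_eq]; omega⟩

variable (k) in
/-- The sign `s(B, C)` in `v_{B ∪ C} = s(B, C) v_B ∧ v_C`, as an element of `k`. -/
def sign (B C : Finset ι) : k := (-1) ^ inversions B C

/-- The two ways to arrive at the decomposition `D`, `B \ D`, `A \ B` of `A`, by splitting off the
last or the first part, give the same sign. -/
theorem sign_mul_sign {A B D : Finset ι} (hB : B ⊆ A) (hD : D ⊆ B) :
    sign k B (A \ B) * sign k D (B \ D) =
      sign k D (A \ D) * sign k (B \ D) ((A \ D) \ (B \ D)) := by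
  have e1 : A \ D = (A \ B) ∪ (B \ D) := by
    ext x; simp only [Finset.mem_sdiff, Finset.mem_union]
    have := @hB x; have := @hD x; tauto
  have e2 : (A \ D) \ (B \ D) = A \ B := by
    ext x; simp only [Finset.mem_sdiff]
    have := @hB x; have := @hD x; tauto
  have h1 : inversions B (A \ B) = inversions D (A \ B) + inversions (B \ D) (A \ B) := by
    conv_lhs => rw [← Finset.union_sdiff_of_subset hD]
    rw [inversions_union_left Finset.disjoint_sdiff, Finset.union_sdiff_of_subset hD]
  have h2 : inversions D (A \ D) = inversions D (A \ B) + inversions D (B \ D) := by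
    rw [e1, inversions_union_right]
    exact Finset.disjoint_left.2 fun x hx hx' =>
      (Finset.mem_sdiff.1 hx).2 (Finset.mem_sdiff.1 hx').1
  unfold sign
  rw [e2, h1, h2]
  ring

/-- Coassociativity of the reduced coproduct of the exterior algebra, in terms of a basis. -/
theorem sum_splitLetter_prepend (A : Finset ι) (x : WordModule k ι) :
    ∑ B ∈ splits A, sign k B (A \ B) • splitLetter (sign k) B (prepend (A \ B) x) =
      ∑ B ∈ splits A, sign k B (A \ B) • prepend B (splitLetter (sign k) (A \ B) x) := by
  simp only [splitLetter_apply, map_sum, map_smul, Finset.smul_sum, smul_smul]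
  rw [Finset.sum_sigma', Finset.sum_sigma']
  -- Both sides run over the ordered partitions of `A` into three parts.
  refine Finset.sum_bij' (fun x _ => ⟨x.2, x.1 \ x.2⟩) (fun x _ => ⟨x.1 ∪ x.2, x.1⟩)
    ?_ ?_ ?_ ?_ ?_
  · rintro ⟨B, D⟩ h
    simp only [Finset.mem_sigma, mem_splits] at h ⊢
    obtain ⟨⟨h1, ⟨y, hy⟩, h3⟩, h4, ⟨z, hz⟩, h6⟩ := h
    have hz' := Finset.mem_sdiff.1 hz
    have hy' := Finset.mem_sdiff.1 hy
    refine ⟨⟨h4, ⟨z, ?_⟩, h6.trans h3⟩, ⟨z, hz⟩, ⟨y, ?_⟩, Finset.sdiff_subset_sdiff h3 le_rfl⟩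
    · exact Finset.mem_sdiff.2 ⟨h3 hz'.1, hz'.2⟩
    · simp only [Finset.mem_sdiff]
      exact ⟨⟨hy'.1, fun h => hy'.2 (h6 h)⟩, fun h => hy'.2 h.1⟩
  · rintro ⟨B, D⟩ h
    simp only [Finset.mem_sigma, mem_splits] at h ⊢
    obtain ⟨⟨h1, -, h3⟩, ⟨z, hz⟩, ⟨y, hy⟩, h6⟩ := h
    have hy' := Finset.mem_sdiff.1 hy
    have hy'' := Finset.mem_sdiff.1 hy'.1
    have hz' := Finset.mem_sdiff.1 (h6 hz)
    refine ⟨⟨h1.mono Finset.subset_union_left, ⟨y, ?_⟩,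
      Finset.union_subset h3 (h6.trans Finset.sdiff_subset)⟩, h1, ⟨z, ?_⟩,
      Finset.subset_union_left⟩
    · simp only [Finset.mem_sdiff, Finset.mem_union, not_or]
      exact ⟨hy''.1, hy''.2, hy'.2⟩
    · exact Finset.mem_sdiff.2 ⟨Finset.mem_union_right _ hz, hz'.2⟩
  · rintro ⟨B, D⟩ h
    simp only [Finset.mem_sigma, mem_splits] at h
    simp only [Finset.union_sdiff_of_subset h.2.2.2]
  · rintro ⟨B, D⟩ h
    simp only [Finset.mem_sigma, mem_splits] at h
    have : (B ∪ D) \ B = D := by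
      rw [Finset.union_sdiff_left]
      exact Finset.sdiff_eq_self_of_disjoint
        (Finset.disjoint_left.2 fun x hx hx' => (Finset.mem_sdiff.1 (h.2.2.2 hx)).2 hx')
    simp only [this]
  · rintro ⟨B, D⟩ h
    simp only [Finset.mem_sigma, mem_splits] at h
    have e2 : (A \ D) \ (B \ D) = A \ B := by
      ext x; simp only [Finset.mem_sdiff]
      have := @h.1.2.2 x; have := @h.2.2.2 x; tauto
    rw [sign_mul_sign h.1.2.2 h.2.2.2]
    simp only [e2]

theorem wordDelta_wordDelta (x : WordModule k ι) :
    wordDelta (sign k) (wordDelta (sign k) x) = 0 := by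
  have key : wordDelta (sign k) ∘ₗ wordDelta (sign k) = (0 : WordModule k ι →ₗ[k] _) := by
    refine Finsupp.lhom_ext' fun L => LinearMap.ext_ring ?_
    simp only [LinearMap.comp_apply, LinearMap.zero_apply, Finsupp.lsingle_apply]
    induction L with
    | nil => simp [wordDeltaAux]
    | cons A l ih =>
      have h : wordDelta (sign k) (splitLetter (sign k) A (Finsupp.single l 1)) =
          splitLetter (sign k) A (wordDelta (sign k) (Finsupp.single l 1)) := by
        rw [splitLetter_apply]
        simp only [map_sum, map_smul, wordDelta_prepend, map_sub, smul_sub,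
          Finset.sum_sub_distrib, sum_splitLetter_prepend]
        rw [splitLetter_apply]
        abel
      rw [← prepend_single, wordDelta_prepend, map_sub, wordDelta_prepend, ih, h]
      simp
  exact LinearMap.congr_fun key x

/-! ### The contracting homotopy -/

variable (k) in
/-- The coefficients of the part of the differential which does not change the weight. -/
def lowestCoeff (B C : Finset ι) : k := if Below B C then 1 else 0

/-- The contracting homotopy on a word with nonempty letters. Write every letter as an increasing
sequence and look for the first ascent in the concatenation. If it occurs between two letters,
these letters (the first of which has then one element) are merged, with the sign from the graded
Leibniz rule; if there is no ascent, or the first one lies inside a letter, the value is zero. -/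
def contractAux : List (Finset ι) → WordModule k ι
  | [] => 0
  | [_] => 0
  | A :: B :: l =>
    if A.card = 1 then
      if Below A B then Finsupp.single ((A ∪ B) :: l) 1 else - prepend A (contractAux (B :: l))
    else 0

variable (k ι) in
/-- The linear extension of `contractAux`. -/
def contract : WordModule k ι →ₗ[k] WordModule k ι :=
  Finsupp.linearCombination k contractAux

@[simp]
theorem contract_single (L : List (Finset ι)) :
    contract k ι (Finsupp.single L 1) = contractAux L := by
  simp [contract]

/-- The contraction undoes a splitting without inversions. -/
theorem contractAux_mem (L : List (Finset ι)) (hL : ∀ A ∈ L, 1 ≤ A.card) :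
    contractAux L ∈ Finsupp.supported k k {L' | SplitsTo L' L 0} := by
  induction L with
  | nil => exact zero_mem _
  | cons A l ih =>
    rcases l with _ | ⟨B, l⟩
    · exact zero_mem _
    rw [contractAux]
    split_ifs with h1 h2
    · refine Finsupp.single_mem_supported k _ ?_
      have := SplitsTo.head A B l h2.disjoint (Finset.card_pos.1 (hL A (by simp)))
        (Finset.card_pos.1 (hL B (by simp)))
      rwa [h2.inversions_eq_zero] at this
    · refine neg_mem (prepend_mem_supported A ?_
        (ih fun D hD => hL D (List.mem_cons_of_mem _ hD)))
      exact fun L' h => h.tail A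
    · exact zero_mem _

theorem contract_mem {t p m : ℕ} {x : WordModule k ι} (hx : x ∈ wordFiltration k ι t (p + 1) m) :
    contract k ι x ∈ wordFiltration k ι t p m := by
  refine mem_of_forall_single _ ?_ hx
  rintro L ⟨hL, hm⟩
  rw [contract_single]
  refine Finsupp.supported_mono ?_ (contractAux_mem L (List.forall_mem_map.1 hL.1))
  rintro L' h
  refine ⟨(h.isComposition_iff t p).1 hL, ?_⟩
  rwa [h.weight_eq] at hm

theorem contract_prepend_eq_zero {A : Finset ι} (hA : A.card ≠ 1) (x : WordModule k ι) :
    contract k ι (prepend A x) = 0 := by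
  have : contract k ι ∘ₗ prepend A = 0 := by
    refine Finsupp.lhom_ext' fun L => LinearMap.ext_ring ?_
    rcases L with _ | ⟨B, l⟩ <;> simp [contractAux, hA]
  exact LinearMap.congr_fun this x

theorem contract_prepend_prepend_of_below {A B : Finset ι} (hA : A.card = 1) (h : Below A B)
    (x : WordModule k ι) : contract k ι (prepend A (prepend B x)) = prepend (A ∪ B) x := by
  have : contract k ι ∘ₗ prepend A ∘ₗ prepend B = prepend (A ∪ B) := by
    refine Finsupp.lhom_ext' fun L => LinearMap.ext_ring ?_
    simp only [LinearMap.comp_apply, Finsupp.lsingle_apply, prepend_single, contract_single,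
      contractAux, if_pos hA, if_pos h]
  exact LinearMap.congr_fun this x

theorem contract_prepend_prepend_of_not_below {A B : Finset ι} (hA : A.card = 1)
    (h : ¬ Below A B) (x : WordModule k ι) :
    contract k ι (prepend A (prepend B x)) = - prepend A (contract k ι (prepend B x)) := by
  have : contract k ι ∘ₗ prepend A ∘ₗ prepend B = - (prepend A ∘ₗ contract k ι ∘ₗ prepend B) := by
    refine Finsupp.lhom_ext' fun L => LinearMap.ext_ring ?_
    simp only [LinearMap.comp_apply, Finsupp.lsingle_apply, prepend_single, contract_single,
      contractAux, if_pos hA, if_neg h, LinearMap.neg_apply]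
  exact LinearMap.congr_fun this x

/-- A letter with at least two elements has its first ascent inside: of all its splittings, only the
one which splits off the minimum is merged again by the contraction. -/
theorem contract_splitLetter_lowest {A : Finset ι} (hA : 2 ≤ A.card) (x : WordModule k ι) :
    contract k ι (splitLetter (lowestCoeff k) A x) = prepend A x := by
  have hne : A.Nonempty := Finset.card_pos.1 (by omega)
  set a := A.min' hne
  have haA : a ∈ A := A.min'_mem hne
  have hbelow : Below {a} (A \ {a}) := by
    intro y hy z hz
    obtain rfl := Finset.mem_singleton.1 hy
    rw [Finset.mem_sdiff, Finset.mem_singleton] at hz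
    exact lt_of_le_of_ne (A.min'_le z hz.1) (Ne.symm hz.2)
  simp only [splitLetter_apply, map_sum, map_smul]
  rw [Finset.sum_eq_single {a}]
  · rw [lowestCoeff, if_pos hbelow, one_smul,
      contract_prepend_prepend_of_below (Finset.card_singleton a) hbelow,
      Finset.union_sdiff_of_subset (Finset.singleton_subset_iff.2 haA)]
  · intro B hB hBa
    by_cases h1 : B.card = 1
    · obtain ⟨b, rfl⟩ := Finset.card_eq_one.1 h1
      rw [lowestCoeff, if_neg, zero_smul]
      intro h
      have hab : a ≠ b := fun h => hBa (by rw [h])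
      have := h b (Finset.mem_singleton_self b) a
        (Finset.mem_sdiff.2 ⟨haA, by simpa using hab⟩)
      exact absurd (A.min'_le b ((mem_splits.1 hB).2.2 (Finset.mem_singleton_self b))) this.not_ge
    · rw [contract_prepend_eq_zero h1, smul_zero]
  · intro h
    exfalso
    refine h (mem_splits.2 ⟨⟨a, by simp⟩, ?_, by simpa using haA⟩)
    rw [← Finset.card_pos, Finset.card_sdiff_of_subset (by simpa using haA),
      Finset.card_singleton]
    omega

/-- If `a` lies below `B`, the splittings of `{a} ∪ B` into a lower and an upper part are
`{a}`, `B` and those obtained from the splittings of `B` by adding `a` to the lower part. -/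
theorem splitLetter_lowest_insert {a : ι} {B : Finset ι} (hB : B.Nonempty) (h : Below {a} B)
    (x : WordModule k ι) :
    splitLetter (lowestCoeff k) ({a} ∪ B) x = prepend {a} (prepend B x) +
      ∑ C ∈ splits B, lowestCoeff k C (B \ C) • prepend ({a} ∪ C) (prepend (B \ C) x) := by
  have haB : a ∉ B := fun ha => (h a (by simp) a ha).false
  have haC : ∀ C ∈ splits B, a ∉ C := fun C hC ha => haB ((mem_splits.1 hC).2.2 ha)
  have hsub : insert {a} ((splits B).image ({a} ∪ ·)) ⊆ splits ({a} ∪ B) := by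
    intro X hX
    rw [Finset.mem_insert, Finset.mem_image] at hX
    rcases hX with rfl | ⟨C, hC, rfl⟩
    · refine mem_splits.2 ⟨⟨a, by simp⟩, ?_, Finset.subset_union_left⟩
      obtain ⟨b, hb⟩ := hB
      exact ⟨b, by simp only [Finset.mem_sdiff, Finset.mem_union, Finset.mem_singleton]
                   exact ⟨Or.inr hb, fun e => haB (e ▸ hb)⟩⟩
    · obtain ⟨h1, ⟨b, hb⟩, h3⟩ := mem_splits.1 hC
      refine mem_splits.2 ⟨⟨a, by simp⟩, ⟨b, ?_⟩, Finset.union_subset_union_right h3⟩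
      rw [Finset.mem_sdiff] at hb
      simp only [Finset.mem_sdiff, Finset.mem_union, Finset.mem_singleton, not_or]
      exact ⟨Or.inr hb.1, fun e => haB (e ▸ hb.1), hb.2⟩
  rw [splitLetter_apply, ← Finset.sum_subset hsub, Finset.sum_insert, Finset.sum_image]
  · congr 1
    · have e : ({a} ∪ B) \ {a} = B := by
        rw [Finset.union_sdiff_left]
        exact Finset.sdiff_eq_self_of_disjoint (by simpa using haB)
      rw [e, lowestCoeff, if_pos h, one_smul]
    · refine Finset.sum_congr rfl fun C hC => ?_
      have e : ({a} ∪ B) \ ({a} ∪ C) = B \ C := by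
        ext y
        simp only [Finset.mem_sdiff, Finset.mem_union, Finset.mem_singleton, not_or]
        constructor
        · rintro ⟨h1 | h1, h2, h3⟩
          · exact absurd h1 h2
          · exact ⟨h1, h3⟩
        · rintro ⟨h1, h2⟩
          exact ⟨Or.inr h1, fun e => haB (e ▸ h1), h2⟩
      have e' : Below ({a} ∪ C) (B \ C) ↔ Below C (B \ C) := by
        constructor
        · exact fun h' y hy => h' y (Finset.mem_union_right _ hy)
        · intro h' y hy z hz
          rcases Finset.mem_union.1 hy with hy | hy
          · exact h y hy z (Finset.mem_sdiff.1 hz).1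
          · exact h' y hy z hz
      simp only [e, lowestCoeff, e']
  · intro C hC C' hC' heq
    have h1 := haC C hC
    have h2 := haC C' hC'
    simp only [Finset.singleton_union] at heq
    rw [← Finset.erase_insert h1, heq, Finset.erase_insert h2]
  · intro hmem
    obtain ⟨C, hC, hCa⟩ := Finset.mem_image.1 hmem
    obtain ⟨c, hc⟩ := (mem_splits.1 hC).1
    have : c ∈ ({a} : Finset ι) := hCa ▸ Finset.mem_union_right _ hc
    exact haC C hC (Finset.mem_singleton.1 this ▸ hc)
  · intro X hX hX'
    obtain ⟨⟨y, hy⟩, h2, h3⟩ := mem_splits.1 hX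
    rw [lowestCoeff, if_neg, zero_smul]
    intro hb
    have haX : a ∈ X := by
      by_contra haX
      have h4 := hb y hy a (Finset.mem_sdiff.2 ⟨by simp, haX⟩)
      rcases Finset.mem_union.1 (h3 hy) with h5 | h5
      · exact haX (Finset.mem_singleton.1 h5 ▸ hy)
      · exact (h a (by simp) y h5).not_gt h4
    apply hX'
    rw [Finset.mem_insert, Finset.mem_image]
    by_cases hXa : X = {a}
    · exact Or.inl hXa
    · refine Or.inr ⟨X.erase a, mem_splits.2 ⟨?_, ?_, ?_⟩, ?_⟩
      · rw [Finset.erase_nonempty haX]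
        exact (Finset.nontrivial_iff_ne_singleton haX).2 hXa
      · obtain ⟨z, hz⟩ := h2
        rw [Finset.mem_sdiff] at hz
        refine ⟨z, Finset.mem_sdiff.2 ⟨?_, fun h => hz.2 (Finset.mem_of_mem_erase h)⟩⟩
        rcases Finset.mem_union.1 hz.1 with h5 | h5
        · exact absurd (Finset.mem_singleton.1 h5 ▸ haX) hz.2
        · exact h5
      · intro z hz
        rw [Finset.mem_erase] at hz
        rcases Finset.mem_union.1 (h3 hz.2) with h5 | h5
        · exact absurd (Finset.mem_singleton.1 h5) hz.1
        · exact h5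
      · rw [Finset.singleton_union, Finset.insert_erase haX]

/-- The contracting homotopy for the weight-preserving part of the differential: `h δ₀ + δ₀ h` is
zero on standard words and the identity on all others. -/
theorem lowest_homotopy (L : List (Finset ι)) (hL : ∀ A ∈ L, 1 ≤ A.card) :
    (IsStandard L ∧ contract k ι (wordDelta (lowestCoeff k) (Finsupp.single L 1)) +
        wordDelta (lowestCoeff k) (contract k ι (Finsupp.single L 1)) = 0) ∨
      contract k ι (wordDelta (lowestCoeff k) (Finsupp.single L 1)) +
        wordDelta (lowestCoeff k) (contract k ι (Finsupp.single L 1)) = Finsupp.single L 1 := by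
  induction L with
  | nil => exact Or.inl ⟨⟨[], by simp, rfl⟩, by simp [contractAux, wordDeltaAux]⟩
  | cons A l ih =>
    specialize ih fun D hD => hL D (List.mem_cons_of_mem _ hD)
    by_cases hA : A.card = 1
    · obtain ⟨a, rfl⟩ := Finset.card_eq_one.1 hA
      have hs : ∀ x : WordModule k ι, splitLetter (lowestCoeff k) {a} x = 0 := fun x => by
        rw [splitLetter_apply, splits_singleton, Finset.sum_empty]
      rcases l with _ | ⟨B, l⟩
      · refine Or.inl ⟨⟨[a], by simp, rfl⟩, ?_⟩
        simp [contractAux, wordDeltaAux, hs]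
      · by_cases hB : Below {a} B
        · right
          have hBne : B.Nonempty := Finset.card_pos.1 (hL B (by simp))
          simp only [← prepend_single, wordDelta_prepend,
            contract_prepend_prepend_of_below hA hB, hs, zero_sub, map_neg, map_sub,
            splitLetter_lowest_insert hBne hB]
          rw [splitLetter_apply]
          simp only [map_sum, map_smul]
          have : ∀ C ∈ splits B, lowestCoeff k C (B \ C) • contract k ι (prepend {a} (prepend C
              (prepend (B \ C) (Finsupp.single l 1)))) = lowestCoeff k C (B \ C) •
              prepend ({a} ∪ C) (prepend (B \ C) (Finsupp.single l 1)) := by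
            intro C hC
            rw [contract_prepend_prepend_of_below hA]
            exact fun y hy z hz => hB y hy z ((mem_splits.1 hC).2.2 hz)
          rw [Finset.sum_congr rfl this]
          abel
        -- A nonempty lower part `C` of `B` contains the minimum of `B`, so it does not lie above `a`
        -- either, and the contraction passes over the letter `{a}` in all terms.
        · have key : contract k ι (prepend {a} (wordDelta (lowestCoeff k)
              (prepend B (Finsupp.single l 1)))) = - prepend {a} (contract k ι
              (wordDelta (lowestCoeff k) (prepend B (Finsupp.single l 1)))) := by
            rw [wordDelta_prepend]
            simp only [map_sub, contract_prepend_prepend_of_not_below hA hB]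
            rw [splitLetter_apply]
            simp only [map_sum, map_smul]
            have : ∀ C ∈ splits B, lowestCoeff k C (B \ C) • contract k ι (prepend {a} (prepend C
                (prepend (B \ C) (Finsupp.single l 1)))) = - (lowestCoeff k C (B \ C) •
                prepend {a} (contract k ι (prepend C
                  (prepend (B \ C) (Finsupp.single l 1))))) := by
              intro C hC
              by_cases hc : Below C (B \ C)
              · rw [contract_prepend_prepend_of_not_below hA, smul_neg]
                intro hac
                apply hB
                intro y hy z hz
                by_cases hzC : z ∈ C
                · exact hac y hy z hzC
                · obtain ⟨u, hu⟩ := (mem_splits.1 hC).1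
                  exact (hac y hy u hu).trans (hc u hu z (Finset.mem_sdiff.2 ⟨hz, hzC⟩))
              · simp [lowestCoeff, if_neg hc]
            rw [Finset.sum_congr rfl this, Finset.sum_neg_distrib]
            abel
          have hD : contract k ι (wordDelta (lowestCoeff k) (Finsupp.single ({a} :: B :: l) 1)) +
              wordDelta (lowestCoeff k) (contract k ι (Finsupp.single ({a} :: B :: l) 1)) =
              prepend {a} (contract k ι (wordDelta (lowestCoeff k) (Finsupp.single (B :: l) 1)) +
              wordDelta (lowestCoeff k) (contract k ι (Finsupp.single (B :: l) 1))) := by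
            simp only [← prepend_single _ l, ← prepend_single _ (B :: l)]
            rw [wordDelta_prepend _ {a}, contract_prepend_prepend_of_not_below hA hB, hs, zero_sub,
              map_neg, key, neg_neg, map_neg, wordDelta_prepend _ {a}, hs, zero_sub, neg_neg,
              map_add]
          rw [hD]
          rcases ih with ⟨⟨w, hw, hwl⟩, ih⟩ | ih
          · refine Or.inl ⟨?_, by rw [ih, map_zero]⟩
            rcases w with _ | ⟨b, w⟩
            · simp at hwl
            · refine ⟨a :: b :: w, ?_, by rw [hwl]; rfl⟩
              simp only [List.map_cons, List.cons.injEq] at hwl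
              have hab : b ≤ a := by
                by_contra hab
                apply hB
                rw [hwl.1]
                simpa [Below] using hab
              rw [List.pairwise_cons] at hw ⊢
              refine ⟨?_, List.pairwise_cons.2 hw⟩
              intro c hc
              rcases List.mem_cons.1 hc with rfl | hc
              · exact hab
              · exact (hw.1 c hc).trans hab
          · right
            rw [ih, prepend_single]
    · right
      have hA2 : 2 ≤ A.card := by have := hL A (by simp); omega
      rw [← prepend_single, contract_prepend_eq_zero hA, map_zero, add_zero, wordDelta_prepend,
        map_sub, contract_prepend_eq_zero hA, sub_zero, contract_splitLetter_lowest hA2]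

variable (k ι) in
/-- The span of the standard words which encode basis elements of `T_t^p`. -/
def standardSpan (t p : ℕ) : Submodule k (WordModule k ι) :=
  Finsupp.supported k k {L | IsComposition t p (L.map Finset.card) ∧ IsStandard L}

theorem IsStandard.sum_card {L : List (Finset ι)} (h : IsStandard L) :
    (L.map Finset.card).sum = L.length := by
  obtain ⟨w, -, rfl⟩ := h
  simp [Function.comp_def]

theorem standardSpan_eq_bot {t p : ℕ} (h : p ≠ t) : standardSpan k ι t p = ⊥ := by
  have : {L : List (Finset ι) | IsComposition t p (L.map Finset.card) ∧ IsStandard L} = ∅ := by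
    ext L
    simp only [Set.mem_ofPred_eq, Set.mem_empty_iff_false, iff_false, not_and]
    rintro ⟨-, h2, h3⟩ hs
    rw [List.length_map] at h3
    exact h (by rw [← h2, ← h3, hs.sum_card])
  rw [standardSpan, this, Finsupp.supported_empty]

/-- Words with letter sizes adding up to `t` have at most `t ^ 2` inversions. -/
theorem wordFiltration_eq_bot {t p m : ℕ} (h : t ^ 2 < m) : wordFiltration k ι t p m = ⊥ := by
  have : {L : List (Finset ι) | IsComposition t p (L.map Finset.card) ∧ m ≤ weight L} = ∅ := by
    ext L
    simp only [Set.mem_ofPred_eq, Set.mem_empty_iff_false, iff_false, not_and, not_le]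
    rintro ⟨-, h2, -⟩
    have := weight_le L
    rw [h2] at this
    omega
  rw [wordFiltration, this, Finsupp.supported_empty]

theorem wordFiltration_eq_bot_of_lt {t p m : ℕ} (h : t < p) : wordFiltration k ι t p m = ⊥ := by
  have : {L : List (Finset ι) | IsComposition t p (L.map Finset.card) ∧ m ≤ weight L} = ∅ := by
    ext L
    simp only [Set.mem_ofPred_eq, Set.mem_empty_iff_false, iff_false, not_and]
    rintro ⟨h1, h2, h3⟩
    have := List.card_nsmul_le_sum (L.map Finset.card) 1 h1
    rw [h2, h3] at this
    simp at this
    omega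
  rw [wordFiltration, this, Finsupp.supported_empty]

theorem wordFiltration_mono {t p m m' : ℕ} (h : m ≤ m') :
    wordFiltration k ι t p m' ≤ wordFiltration k ι t p m :=
  Finsupp.supported_mono fun _ hL => ⟨hL.1, h.trans hL.2⟩

theorem standardSpan_le {t p : ℕ} : standardSpan k ι t p ≤ wordFiltration k ι t p 0 :=
  Finsupp.supported_mono fun _ hL => ⟨hL.1, Nat.zero_le _⟩

theorem wordDelta_sign_mem {t p m : ℕ} {x : WordModule k ι}
    (hx : x ∈ wordFiltration k ι t p m) :
    wordDelta (sign k) x ∈ wordFiltration k ι t (p + 1) m :=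
  wordDelta_mem (sign k) 0 (fun _ _ _ _ => Nat.zero_le _) hx

theorem wordDelta_eq_zero_of_standardSpan {t p : ℕ} {x : WordModule k ι}
    (hx : x ∈ standardSpan k ι t p) : wordDelta (sign k) x = 0 := by
  by_cases h : p = t
  · subst h
    have := wordDelta_sign_mem (standardSpan_le hx)
    rw [wordFiltration_eq_bot_of_lt (Nat.lt_succ_self p)] at this
    simpa using this
  · rw [standardSpan_eq_bot h, Submodule.mem_bot] at hx
    rw [hx, map_zero]

/-- The difference between the differential and its weight-preserving part raises the weight. -/
theorem wordDelta_sub_lowest_mem {t p m : ℕ} {x : WordModule k ι}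
    (hx : x ∈ wordFiltration k ι t p m) :
    wordDelta (sign k) x - wordDelta (lowestCoeff k) x ∈ wordFiltration k ι t (p + 1) (m + 1) := by
  rw [← LinearMap.sub_apply, wordDelta_sub]
  refine wordDelta_mem _ 1 (fun B C hd hne => ?_) hx
  by_contra hlt
  have hb : Below B C := by
    by_contra hb
    exact hlt (inversions_pos hd hb)
  exact hne (by rw [sign, hb.inversions_eq_zero, pow_zero, lowestCoeff, if_pos hb, sub_self])

/-- For the whole differential, `h δ + δ h` is the identity up to standard words and words of
higher weight. -/
theorem homotopy_mem {t p m : ℕ} {x : WordModule k ι}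
    (hx : x ∈ wordFiltration k ι t (p + 1) m) :
    x - wordDelta (sign k) (contract k ι x) - contract k ι (wordDelta (sign k) x) ∈
      wordFiltration k ι t (p + 1) (m + 1) ⊔ standardSpan k ι t (p + 1) := by
  have h1 := wordDelta_sub_lowest_mem (contract_mem hx)
  have h2 := contract_mem (wordDelta_sub_lowest_mem hx)
  have h3 : x - (contract k ι (wordDelta (lowestCoeff k) x) +
      wordDelta (lowestCoeff k) (contract k ι x)) ∈ standardSpan k ι t (p + 1) := by
    refine mem_of_forall_single (LinearMap.id - (contract k ι ∘ₗ wordDelta (lowestCoeff k) +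
      wordDelta (lowestCoeff k) ∘ₗ contract k ι)) ?_ hx
    rintro L ⟨hL, -⟩
    simp only [LinearMap.sub_apply, LinearMap.add_apply, LinearMap.comp_apply, LinearMap.id_apply]
    rcases lowest_homotopy (k := k) L (List.forall_mem_map.1 hL.1) with ⟨hs, h⟩ | h
    · rw [h, sub_zero]
      exact Finsupp.single_mem_supported k _ ⟨hL, hs⟩
    · rw [h, sub_self]
      exact zero_mem _
  refine Submodule.mem_sup.2 ⟨_, neg_mem (add_mem h1 h2), _, h3, ?_⟩
  rw [map_sub]
  abel

/-- Every cycle is homologous to a combination of standard words. -/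
theorem exists_sub_wordDelta_mem_standardSpan {t p : ℕ} (m : ℕ) {x : WordModule k ι}
    (hx : x ∈ wordFiltration k ι t (p + 1) m) (hδ : wordDelta (sign k) x = 0) :
    ∃ y ∈ wordFiltration k ι t p 0,
      x - wordDelta (sign k) y ∈ standardSpan k ι t (p + 1) := by
  by_cases hm : t ^ 2 < m
  · rw [wordFiltration_eq_bot hm, Submodule.mem_bot] at hx
    exact ⟨0, zero_mem _, by simp [hx]⟩
  · have h := homotopy_mem hx
    rw [hδ, map_zero, sub_zero] at h
    -- The part `f` of higher weight is again a cycle, since standard words are cycles.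
    obtain ⟨f, hf, z, hz, hfz⟩ := Submodule.mem_sup.1 h
    have hfδ : wordDelta (sign k) f = 0 := by
      have := congrArg (wordDelta (sign k)) hfz
      rwa [map_add, wordDelta_eq_zero_of_standardSpan hz, add_zero, map_sub, hδ,
        wordDelta_wordDelta, sub_zero] at this
    obtain ⟨y, hy, hy'⟩ := exists_sub_wordDelta_mem_standardSpan (m + 1) hf hfδ
    refine ⟨contract k ι x + y,
      add_mem (contract_mem (wordFiltration_mono (Nat.zero_le m) hx)) hy, ?_⟩
    have e : x - wordDelta (sign k) (contract k ι x + y) =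
        (f - wordDelta (sign k) y) + z := by
      rw [map_add, sub_add_eq_sub_sub, ← hfz]
      abel
    rw [e]
    exact add_mem hy' hz
termination_by t ^ 2 + 1 - m

end Operators

/-! ### Words as basis elements of the terms of the complex -/

section Realization

variable {k V : Type*} [CommRing k] [AddCommGroup V] [Module k V] {ι : Type*} [LinearOrder ι]
  (b : Module.Basis ι k V)

/-- The basis element `b_{a₁} ∧ ⋯ ∧ b_{a_j}` of `⋀^j V` for `A = {a₁ < ⋯ < a_j}`. -/
def basisWedge (A : Finset ι) : ⋀[k]^A.card V :=
  exteriorPower.ιMulti k A.card fun j => b (A.orderEmbOfFin rfl j)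

/-- The tensor product of the basis elements given by the letters of a word. -/
def wordTensor : (L : List (Finset ι)) → WordTensor k V (L.map Finset.card)
  | [] => PiTensorProduct.tprod k fun j : Fin 0 => j.elim0
  | A :: l => cons A.card (l.map Finset.card) (basisWedge b A) (wordTensor l)

open Classical in
/-- The element of `T_t^p` given by a word; zero if the sizes of the letters do not form a
composition of `t` into `p` parts. -/
def wordVector (t p : ℕ) (L : List (Finset ι)) : T k V t p :=
  if h : IsComposition t p (L.map Finset.card) then incl _ h (wordTensor b L) else 0

/-- The linear extension of `wordVector`. -/
def realize (t p : ℕ) : WordModule k ι →ₗ[k] T k V t p :=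
  Finsupp.linearCombination k (wordVector b t p)

@[simp]
theorem realize_single (t p : ℕ) (L : List (Finset ι)) :
    realize b t p (Finsupp.single L 1) = wordVector b t p L := by
  simp [realize]

theorem wordVector_of_isComposition {t p : ℕ} {L : List (Finset ι)}
    (h : IsComposition t p (L.map Finset.card)) :
    wordVector b t p L = incl _ h (wordTensor b L) := dif_pos h

theorem oneTensor_realize {t p : ℕ} {A : Finset ι} {l : List ℕ}
    (h : IsComposition t p (A.card :: l)) (x : WordModule k ι) :
    oneTensor h (basisWedge b A) (realize b l.sum (l.length + 1) x) =
      realize b t (p + 1) (prepend A x) := by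
  have : oneTensor h (basisWedge b A) ∘ₗ realize b l.sum (l.length + 1) =
      realize b t (p + 1) ∘ₗ prepend A := by
    refine Finsupp.lhom_ext' fun L => LinearMap.ext_ring ?_
    simp only [LinearMap.comp_apply, Finsupp.lsingle_apply, prepend_single, realize_single]
    by_cases hL : IsComposition l.sum (l.length + 1) (L.map Finset.card)
    · have hL' : IsComposition t (p + 1) ((A :: L).map Finset.card) := h.cons hL
      rw [wordVector_of_isComposition b hL, wordVector_of_isComposition b hL', oneTensor_incl]
      rfl
    · have hL' : ¬ IsComposition t (p + 1) ((A :: L).map Finset.card) := by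
        intro hL'
        obtain ⟨h1, h2, h3⟩ := h
        obtain ⟨h1', h2', h3'⟩ := hL'
        simp only [List.map_cons, List.sum_cons, List.length_cons] at h2 h3 h2' h3'
        refine hL ⟨fun i hi => h1' i (List.mem_cons_of_mem _ hi), ?_, ?_⟩ <;> omega
      rw [wordVector, dif_neg hL, wordVector, dif_neg hL', map_zero]
  exact LinearMap.congr_fun this x

theorem incl_cons_cons {t p : ℕ} (B C : Finset ι) (l : List (Finset ι)) (m n : ℕ)
    (hB : B.card = m) (hC : C.card = n)
    (h : IsComposition t (p + 1) (m :: n :: l.map Finset.card)) :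
    incl _ h (cons m _ (exteriorPower.ιMulti k m fun j => b (B.orderEmbOfFin hB j))
      (cons n _ (exteriorPower.ιMulti k n fun j => b (C.orderEmbOfFin hC j)) (wordTensor b l))) =
      wordVector b t (p + 1) (B :: C :: l) := by
  subst hB hC
  rw [wordVector_of_isComposition b (L := B :: C :: l) h]
  rfl

/-- The element `v_X` of the definition of `δ`, for the vectors `v` which belong to a letter `A`, is
the one given by the subset of `A` which corresponds to `X`. -/
theorem wedge_comp_orderEmbOfFin (A : Finset ι) (X : Finset (Fin A.card)) :
    wedge (k := k) (fun j => b (A.orderEmbOfFin rfl j)) X =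
      exteriorPower.ιMulti k X.card fun j =>
        b ((X.map (A.orderEmbOfFin rfl).toEmbedding).orderEmbOfFin (Finset.card_map _) j) := by
  have : (fun j => A.orderEmbOfFin rfl (X.orderEmbOfFin rfl j)) =
      (X.map (A.orderEmbOfFin rfl).toEmbedding).orderEmbOfFin (Finset.card_map _) := by
    refine Finset.orderEmbOfFin_unique _ (fun j => ?_) ?_
    · exact Finset.mem_map_of_mem _ (X.orderEmbOfFin_mem rfl j)
    · exact (A.orderEmbOfFin rfl).strictMono.comp (X.orderEmbOfFin rfl).strictMono
  rw [← this]
  rfl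

theorem map_orderEmbOfFin_compl (A : Finset ι) (X : Finset (Fin A.card)) :
    Xᶜ.map (A.orderEmbOfFin rfl).toEmbedding = A \ X.map (A.orderEmbOfFin rfl).toEmbedding := by
  ext a
  have ha : a ∈ A ↔ ∃ j, A.orderEmbOfFin rfl j = a := by
    rw [← Set.mem_range, Finset.range_orderEmbOfFin, Finset.mem_coe]
  simp only [Finset.mem_map, Finset.mem_sdiff, ha, Finset.mem_compl, RelEmbedding.coe_toEmbedding]
  constructor
  · rintro ⟨j, hj, rfl⟩
    refine ⟨⟨j, rfl⟩, ?_⟩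
    rintro ⟨j', hj', h⟩
    exact hj ((A.orderEmbOfFin rfl).injective h ▸ hj')
  · rintro ⟨⟨j, rfl⟩, h⟩
    exact ⟨j, fun hj => h ⟨j, hj, rfl⟩, rfl⟩

theorem shuffleSign_eq_sign (A : Finset ι) (X Y : Finset (Fin A.card)) :
    (shuffleSign X Y : k) = sign k (X.map (A.orderEmbOfFin rfl).toEmbedding)
      (Y.map (A.orderEmbOfFin rfl).toEmbedding) := by
  have : inversions (X.map (A.orderEmbOfFin rfl).toEmbedding)
      (Y.map (A.orderEmbOfFin rfl).toEmbedding) =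
      ((X ×ˢ Y).filter fun x => x.2 < x.1).card := by
    unfold inversions
    rw [← Finset.prodMap_map_product, Finset.filter_map, Finset.card_map]
    congr 1
    ext x
    refine Finset.mem_filter.trans ?_
    simp
  rw [sign, this, shuffleSign]
  push_cast
  rfl

/-- The coproduct of a basis element of `⋀^i V` in terms of splittings of the letter `A`. -/
theorem twoTensor_deltaOne {t p : ℕ} {A : Finset ι} {l : List (Finset ι)}
    (h : IsComposition t p (A.card :: l.map Finset.card)) :
    twoTensor h (deltaOne A.card (basisWedge b A)) (wordTensor b l) =
      realize b t (p + 1) (splitLetter (sign k) A (Finsupp.single l 1)) := by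
  rw [basisWedge, deltaOne_ιMulti, splitLetter_apply, map_sum, map_sum, LinearMap.sum_apply]
  refine Finset.sum_bij (fun X _ => X.1.map (A.orderEmbOfFin rfl).toEmbedding) ?_ ?_ ?_ ?_
  · intro X _
    rw [mem_splits, ← map_orderEmbOfFin_compl]
    refine ⟨X.2.1.map, X.2.2.map, fun a ha => ?_⟩
    obtain ⟨j, -, rfl⟩ := Finset.mem_map.1 ha
    exact A.orderEmbOfFin_mem rfl j
  · intro X _ Y _ hXY
    exact Subtype.ext (Finset.map_injective _ hXY)
  · intro B hB
    obtain ⟨h1, h2, h3⟩ := mem_splits.1 hB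
    have e : (Finset.univ.filter fun j => A.orderEmbOfFin rfl j ∈ B).map
        (A.orderEmbOfFin rfl).toEmbedding = B := by
      ext a
      simp only [Finset.mem_map, Finset.mem_filter, Finset.mem_univ, true_and,
        RelEmbedding.coe_toEmbedding]
      constructor
      · rintro ⟨j, hj, rfl⟩
        exact hj
      · intro ha
        have ha' : a ∈ Set.range (A.orderEmbOfFin rfl) := by
          rw [Finset.range_orderEmbOfFin]; exact h3 ha
        obtain ⟨j, rfl⟩ := ha'
        exact ⟨j, ha, rfl⟩
    refine ⟨⟨Finset.univ.filter fun j => A.orderEmbOfFin rfl j ∈ B, ?_, ?_⟩,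
      Finset.mem_univ _, e⟩
    · rw [← Finset.map_nonempty (f := (A.orderEmbOfFin rfl).toEmbedding), e]
      exact h1
    · rw [← Finset.map_nonempty (f := (A.orderEmbOfFin rfl).toEmbedding),
        map_orderEmbOfFin_compl, e]
      exact h2
  · intro X _
    rw [← Int.cast_smul_eq_zsmul k, map_smul, LinearMap.smul_apply, map_smul,
      shuffleSign_eq_sign, map_orderEmbOfFin_compl]
    congr 1
    rw [twoTensor_inclTwo, wedge_comp_orderEmbOfFin, wedge_comp_orderEmbOfFin, incl_cons_cons,
      prepend_single, prepend_single, realize_single, map_orderEmbOfFin_compl]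

theorem deltaWord_wordTensor (L : List (Finset ι)) (t p : ℕ)
    (h : IsComposition t p (L.map Finset.card)) :
    deltaWord (L.map Finset.card) t p h (wordTensor b L) =
      realize b t (p + 1) (wordDeltaAux (sign k) L) := by
  induction L generalizing t p with
  | nil =>
    rw [wordDeltaAux, map_zero]
    change deltaWord [] t p h _ = 0
    rw [deltaWord, LinearMap.zero_apply]
  | cons A l ih =>
    refine (deltaWord_cons h _ _).trans ?_
    rw [ih, oneTensor_realize, twoTensor_deltaOne, wordDeltaAux, map_sub]

theorem delta_incl {t p : ℕ} {l : List ℕ} (h : IsComposition t p l) (x : WordTensor k V l) :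
    delta k V t p (incl l h x) = deltaWord l t p h x := by
  unfold delta incl
  rw [DirectSum.toModule_lof]

/-- The differential of the complex corresponds to `wordDelta`. -/
theorem delta_realize {t p m : ℕ} {x : WordModule k ι} (hx : x ∈ wordFiltration k ι t p m) :
    delta k V t p (realize b t p x) = realize b t (p + 1) (wordDelta (sign k) x) := by
  rw [wordFiltration, Finsupp.supported_eq_span_single] at hx
  induction hx using Submodule.span_induction with
  | mem x hx =>
    obtain ⟨L, hL, rfl⟩ := hx
    simp only [realize_single, wordDelta_single]
    rw [wordVector_of_isComposition b hL.1, delta_incl, deltaWord_wordTensor]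
  | zero => simp
  | add x y _ _ hx hy => simp only [map_add, hx, hy]
  | smul r x _ hx => simp only [map_smul, hx]

/-- The coordinates of an element of `⋀^i V` in the basis given by `b`. -/
def wedgeCoord (i : ℕ) : ⋀[k]^i V →ₗ[k] Finset ι →₀ k :=
  Finsupp.lmapDomain k k Subtype.val ∘ₗ (b.exteriorPower i).repr.toLinearMap

theorem wedgeCoord_basisWedge (A : Finset ι) :
    wedgeCoord b A.card (basisWedge b A) = Finsupp.single A 1 := by
  have : basisWedge b A = b.exteriorPower A.card ⟨A, rfl⟩ := by
    rw [exteriorPower.basis_apply]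
    rfl
  rw [wedgeCoord, this, LinearMap.comp_apply, LinearEquiv.coe_coe, Module.Basis.repr_self,
    Finsupp.lmapDomain_apply, Finsupp.mapDomain_single]

theorem span_basisWedge (i : ℕ) (x : ⋀[k]^i V) :
    x ∈ Submodule.span k {y | ∃ (A : Finset ι) (h : A.card = i),
      y = exteriorPower.ιMulti k i fun j => b (A.orderEmbOfFin h j)} := by
  have h := (b.exteriorPower i).mem_span x
  refine Submodule.span_mono ?_ h
  rintro _ ⟨A, rfl⟩
  refine ⟨A.1, A.2, ?_⟩
  rw [exteriorPower.basis_apply]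
  rfl

/-- The coordinates of an element of `⋀^{i₁} V ⊗ ⋯ ⊗ ⋀^{i_p} V` in the basis given by `b`. -/
def tensorCoord : (l : List ℕ) → WordTensor k V l →ₗ[k] WordModule k ι
  | [] => PiTensorProduct.lift (MultilinearMap.constOfIsEmpty k
      (fun j : Fin 0 => ⋀[k]^(([] : List ℕ).get j) V) (Finsupp.single [] 1))
  | i :: l => uncons i l
      ((Finsupp.linearCombination k (prepend (k := k) (ι := ι)) ∘ₗ wedgeCoord b i).compl₂
        (tensorCoord l))

theorem tensorCoord_wordTensor (L : List (Finset ι)) :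
    tensorCoord b (L.map Finset.card) (wordTensor b L) = Finsupp.single L 1 := by
  induction L with
  | nil =>
    rw [wordTensor]
    erw [PiTensorProduct.lift.tprod]
    rfl
  | cons A l ih =>
    refine (uncons_cons _ _ _ _ _).trans ?_
    rw [LinearMap.compl₂_apply, ih, LinearMap.comp_apply, wedgeCoord_basisWedge,
      Finsupp.linearCombination_single, one_smul, prepend_single]

/-- The coordinates of an element of `T_t^p` in the basis given by `b`. -/
def coord (t p : ℕ) : T k V t p →ₗ[k] WordModule k ι :=
  DirectSum.toModule k _ _ fun c => tensorCoord b c.1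

/-- Together with `exists_realize_eq` this says that `realize` restricts to an isomorphism from the
span of the words with the right letter sizes to `T_t^p`. -/
theorem coord_realize {t p m : ℕ} {x : WordModule k ι} (hx : x ∈ wordFiltration k ι t p m) :
    coord b t p (realize b t p x) = x := by
  rw [wordFiltration, Finsupp.supported_eq_span_single] at hx
  induction hx using Submodule.span_induction with
  | mem x hx =>
    obtain ⟨L, hL, rfl⟩ := hx
    simp only [realize_single]
    rw [wordVector_of_isComposition b hL.1, coord, incl, DirectSum.toModule_lof,
      tensorCoord_wordTensor]
  | zero => simp
  | add x y _ _ hx hy => simp only [map_add, hx, hy]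
  | smul r x _ hx => simp only [map_smul, hx]

/-- The tensors given by words span. The transport `▸` is along the equality between the sizes of
the letters of the word and `l`. -/
theorem span_wordTensor (l : List ℕ) (x : WordTensor k V l) :
    x ∈ Submodule.span k {y | ∃ (L : List (Finset ι)) (h : L.map Finset.card = l),
      y = h ▸ wordTensor b L} := by
  induction l with
  | nil =>
    induction x using PiTensorProduct.induction_on with
    | smul_tprod r f =>
      refine Submodule.smul_mem _ _ (Submodule.subset_span ⟨[], rfl, ?_⟩)
      exact congrArg _ (funext fun j => j.elim0)
    | add x y hx hy => exact add_mem hx hy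
  | cons i l ih =>
    -- Pure tensors have the form `cons i l α β`, and `cons` is bilinear.
    have key : ∀ (α : ⋀[k]^i V) (β : WordTensor k V l), cons i l α β ∈
        Submodule.span k {y | ∃ (L : List (Finset ι)) (h : L.map Finset.card = i :: l),
          y = h ▸ wordTensor b L} := by
      intro α β
      induction span_basisWedge b i α using Submodule.span_induction with
      | mem α hα =>
        obtain ⟨A, rfl, rfl⟩ := hα
        induction ih β using Submodule.span_induction with
        | mem β hβ =>
          obtain ⟨L, rfl, rfl⟩ := hβ
          exact Submodule.subset_span ⟨A :: L, rfl, rfl⟩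
        | zero => rw [map_zero]; exact zero_mem _
        | add β β' _ _ h h' => rw [map_add]; exact add_mem h h'
        | smul r β _ h => rw [map_smul]; exact Submodule.smul_mem _ r h
      | zero => rw [map_zero]; exact zero_mem _
      | add α α' _ _ h h' => rw [map_add]; exact add_mem h h'
      | smul r α _ h => rw [map_smul]; exact Submodule.smul_mem _ r h
    induction x using PiTensorProduct.induction_on with
    | smul_tprod r f =>
      refine Submodule.smul_mem _ _ ?_
      have e : PiTensorProduct.tprod k f = cons i l (f 0) (PiTensorProduct.tprod k
          (s := fun j : Fin l.length => ⋀[k]^(l.get j) V) fun j => f j.succ) :=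
        (congrArg _ (Fin.cons_self_tail f).symm).trans
          (cons_tprod i l (f 0) fun j => f j.succ).symm
      rw [e]
      exact key _ _
    | add x y hx hy => exact add_mem hx hy

theorem exists_realize_eq {t p : ℕ} (x : T k V t p) :
    ∃ y ∈ wordFiltration k ι t p 0, realize b t p y = x := by
  have key : ∀ x : T k V t p, x ∈ (wordFiltration k ι t p 0).map (realize b t p) := by
    intro x
    induction x using DirectSum.induction_on with
    | zero => exact zero_mem _
    | add x y hx hy => exact add_mem hx hy
    | of c x =>
      obtain ⟨l, hc⟩ := c
      change incl l hc x ∈ _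
      induction span_wordTensor b l x using Submodule.span_induction with
      | mem x hx =>
        obtain ⟨L, rfl, rfl⟩ := hx
        refine ⟨Finsupp.single L 1, Finsupp.single_mem_supported k _ ⟨hc, Nat.zero_le _⟩, ?_⟩
        rw [realize_single, wordVector_of_isComposition b hc]
      | zero => rw [map_zero]; exact zero_mem _
      | add x y _ _ h h' => rw [map_add]; exact add_mem h h'
      | smul r x _ h => rw [map_smul]; exact Submodule.smul_mem _ r h
  exact key x

/-! ### The projection to the symmetric power -/

theorem piWord_tprod (l : List ℕ) (f : ∀ j : Fin l.length, ⋀[k]^(l.get j) V) :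
    piWord l (PiTensorProduct.tprod k f) = ∏ j, toSym (l.get j) (f j) := by
  simp [piWord]

theorem piWord_cons (i : ℕ) (l : List ℕ) (α : ⋀[k]^i V) (β : WordTensor k V l) :
    piWord (i :: l) (cons i l α β) = toSym i α * piWord l β := by
  induction β using PiTensorProduct.induction_on with
  | smul_tprod r f =>
    rw [map_smul, map_smul, map_smul, mul_smul_comm, cons_tprod]
    refine congrArg (r • ·) ?_
    rw [piWord_tprod l f]
    exact (piWord_tprod (i :: l) _).trans (Fin.prod_univ_succ _)
  | add x y hx hy => rw [map_add, map_add, map_add, hx, hy, mul_add]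

/-- The image of a letter in the symmetric algebra. -/
def letterSym (A : Finset ι) : SymmetricAlgebra k V := toSym A.card (basisWedge b A)

theorem letterSym_singleton (a : ι) : letterSym b {a} = SymmetricAlgebra.ι k V (b a) := by
  refine (exteriorPower.alternatingMapLinearEquiv_apply_ιMulti _ _).trans ?_
  exact congrArg (fun x => SymmetricAlgebra.ι k V (b x))
    (Finset.mem_singleton.1 (Finset.orderEmbOfFin_mem {a} rfl (0 : Fin 1)))

theorem letterSym_eq_zero {A : Finset ι} (h : A.card ≠ 1) : letterSym b A = 0 := by
  have : ∀ (i : ℕ) (_ : i ≠ 1) (x : ⋀[k]^i V), toSym i x = 0 := by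
    intro i hi x
    unfold toSym
    split
    · exact absurd rfl hi
    · rfl
  exact this _ h _

/-- The map on words which corresponds to `π`. -/
def wordSym : WordModule k ι →ₗ[k] SymmetricAlgebra k V :=
  Finsupp.linearCombination k fun L => (L.map (letterSym b)).prod

@[simp]
theorem wordSym_single (L : List (Finset ι)) :
    wordSym b (Finsupp.single L 1) = (L.map (letterSym b)).prod := by
  simp [wordSym]

theorem piWord_wordTensor (L : List (Finset ι)) :
    piWord (L.map Finset.card) (wordTensor b L) = (L.map (letterSym b)).prod := by
  induction L with
  | nil => exact (piWord_tprod [] _).trans (Fin.prod_univ_zero _)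
  | cons A l ih =>
    refine (piWord_cons _ _ _ _).trans ?_
    rw [ih, List.map_cons, List.prod_cons, letterSym]

theorem proj_realize {t p m : ℕ} (h : p = t) {x : WordModule k ι}
    (hx : x ∈ wordFiltration k ι t p m) :
    (proj k V h (realize b t p x) : SymmetricAlgebra k V) = wordSym b x := by
  rw [wordFiltration, Finsupp.supported_eq_span_single] at hx
  induction hx using Submodule.span_induction with
  | mem x hx =>
    obtain ⟨L, hL, rfl⟩ := hx
    simp only [realize_single, wordSym_single]
    rw [wordVector_of_isComposition b hL.1, proj, incl, DirectSum.toModule_lof,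
      LinearMap.codRestrict_apply, piWord_wordTensor]
  | zero => simp
  | add x y _ _ hx hy => simp only [map_add, Submodule.coe_add, hx, hy]
  | smul r x _ hx => simp only [map_smul, Submodule.coe_smul, hx]

theorem wordSym_prepend (A : Finset ι) (x : WordModule k ι) :
    wordSym b (prepend A x) = letterSym b A * wordSym b x := by
  induction x using Finsupp.induction_linear with
  | zero => simp
  | add x y hx hy => simp only [map_add, hx, hy, mul_add]
  | single L r =>
    have h : (Finsupp.single L r : WordModule k ι) = r • Finsupp.single L 1 := by simp
    rw [h, map_smul, map_smul, map_smul, prepend_single, wordSym_single, wordSym_single,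
      List.map_cons, List.prod_cons, mul_smul_comm]

/-- Only the splittings of a two-element letter contribute, and these cancel, because the symmetric
algebra is commutative and exchanging the two parts changes the sign. -/
theorem wordSym_splitLetter (A : Finset ι) (x : WordModule k ι) :
    wordSym b (splitLetter (sign k) A x) = 0 := by
  rw [splitLetter_apply, map_sum]
  simp only [map_smul, wordSym_prepend]
  refine Finset.sum_involution (fun B _ => A \ B) ?_ ?_ ?_ ?_
  · intro B hB
    have hBA := (mem_splits.1 hB).2.2
    rw [Finset.sdiff_sdiff_eq_self hBA]
    by_cases h1 : B.card = 1
    · by_cases h2 : (A \ B).card = 1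
      · obtain ⟨x, hx⟩ := Finset.card_eq_one.1 h1
        obtain ⟨y, hy⟩ := Finset.card_eq_one.1 h2
        have hne : x ≠ y := by
          rintro rfl
          exact (Finset.mem_sdiff.1 (hy ▸ Finset.mem_singleton_self x : x ∈ A \ B)).2 (by simp [hx])
        have hs : sign k B (A \ B) = - sign k (A \ B) B := by
          rw [hy, hx]
          unfold sign inversions
          rcases hne.lt_or_gt with h | h <;>
            simp [Finset.filter_singleton, h, h.not_gt]
        rw [hs, neg_smul, mul_left_comm (letterSym b B), neg_add_cancel]
      · simp [letterSym_eq_zero b h2]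
    · simp [letterSym_eq_zero b h1]
  · intro B hB _ h
    obtain ⟨x, hx⟩ := (mem_splits.1 hB).1
    have hx' := hx
    rw [← h] at hx'
    exact (Finset.mem_sdiff.1 hx').2 hx
  · intro B hB
    obtain ⟨h1, h2, h3⟩ := mem_splits.1 hB
    exact mem_splits.2 ⟨h2, by rwa [Finset.sdiff_sdiff_eq_self h3], Finset.sdiff_subset⟩
  · intro B hB
    exact Finset.sdiff_sdiff_eq_self (mem_splits.1 hB).2.2

theorem wordSym_wordDelta (x : WordModule k ι) : wordSym b (wordDelta (sign k) x) = 0 := by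
  have key : wordSym b ∘ₗ wordDelta (sign k) = 0 := by
    refine Finsupp.lhom_ext' fun L => LinearMap.ext_ring ?_
    simp only [LinearMap.comp_apply, LinearMap.zero_apply, Finsupp.lsingle_apply]
    induction L with
    | nil => simp [wordDeltaAux]
    | cons A l ih =>
      rw [← prepend_single, wordDelta_prepend, map_sub, wordSym_splitLetter, wordSym_prepend, ih,
        mul_zero, sub_zero]
  exact LinearMap.congr_fun key x

/-- Standard words correspond to the monomials in the symmetric algebra. -/
theorem eq_zero_of_mem_standardSpan {t p : ℕ} {x : WordModule k ι}
    (hx : x ∈ standardSpan k ι t p) (h : wordSym b x = 0) : x = 0 := by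
  classical
  -- The exponent of `a` in the monomial of a standard word is the multiplicity of the letter `{a}`.
  let e : List (Finset ι) → ι →₀ ℕ := fun L => (L.map fun A => ∑ a ∈ A, Finsupp.single a 1).sum
  have he : ∀ w : List ι, e (w.map fun a => {a}) = Multiset.toFinsupp (w : Multiset ι) := by
    intro w
    induction w with
    | nil => simp [e]
    | cons a w ih =>
      rw [← Multiset.cons_coe, ← Multiset.singleton_add, map_add, Multiset.toFinsupp_singleton,
        ← ih]
      simp [e]
  have hmon : ∀ L : List (Finset ι), IsStandard L →
      (L.map (letterSym b)).prod = b.symmetricAlgebra (e L) := by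
    rintro _ ⟨w, -, rfl⟩
    have hb : ∀ d, b.symmetricAlgebra d =
        (SymmetricAlgebra.equivMvPolynomial b).symm (MvPolynomial.monomial d 1) := by
      intro d
      simp [Module.Basis.symmetricAlgebra]
    induction w with
    | nil => simp [hb, e]
    | cons a w ih =>
      have : e ({a} :: w.map fun a => {a}) = Finsupp.single a 1 + e (w.map fun a => {a}) := by
        simp [e]
      simp only [List.map_cons, List.prod_cons] at ih ⊢
      have hX : ∀ d, MvPolynomial.monomial (Finsupp.single a 1 + d) (1 : k) =
          MvPolynomial.X a * MvPolynomial.monomial d 1 := by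
        intro d
        rw [MvPolynomial.X, MvPolynomial.monomial_mul, one_mul]
      rw [ih, hb, hb, this, hX, letterSym_singleton, map_mul,
        SymmetricAlgebra.equivMvPolynomial_symm_X]
  have hinj : Set.InjOn e {L | IsStandard L} := by
    rintro _ ⟨w, hw, rfl⟩ _ ⟨w', hw', rfl⟩ h
    rw [he, he, EmbeddingLike.apply_eq_iff_eq, Multiset.coe_eq_coe] at h
    rw [h.eq_of_pairwise (fun a b _ _ h h' => le_antisymm h' h) hw hw']
  have hli : LinearIndepOn k (fun L => (L.map (letterSym b)).prod)
      {L : List (Finset ι) | IsComposition t p (L.map Finset.card) ∧ IsStandard L} := by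
    have h1 : LinearIndepOn k (fun L => b.symmetricAlgebra (e L))
        {L : List (Finset ι) | IsComposition t p (L.map Finset.card) ∧ IsStandard L} :=
      b.symmetricAlgebra.linearIndependent.comp (fun L : {L : List (Finset ι) |
        IsComposition t p (L.map Finset.card) ∧ IsStandard L} => e L.1)
        fun L L' h => Subtype.ext (hinj L.2.2 L'.2.2 h)
    exact h1.congr fun L hL => (hmon L hL.2).symm
  exact linearIndepOn_iff.1 hli x hx h

theorem exists_wordSym_eq {t : ℕ} {s : SymmetricAlgebra k V} (hs : s ∈ SymPower k V t) :
    ∃ x ∈ wordFiltration k ι t t 0, wordSym b x = s := by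
  have key : SymPower k V t ≤ (wordFiltration k ι t t 0).map (wordSym b) := by
    clear hs
    induction t with
    | zero =>
      rw [SymPower, pow_zero, Submodule.one_le]
      refine ⟨Finsupp.single [] 1, Finsupp.single_mem_supported k _ ⟨?_, Nat.zero_le _⟩, by simp⟩
      simp [IsComposition]
    | succ t ih =>
      rw [SymPower, pow_succ', Submodule.mul_le]
      rintro _ ⟨v, rfl⟩ y hy
      obtain ⟨x, hx, rfl⟩ := ih hy
      induction b.mem_span v using Submodule.span_induction with
      | mem v hv =>
        obtain ⟨a, rfl⟩ := hv
        refine ⟨prepend {a} x, prepend_mem_supported _ ?_ hx, ?_⟩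
        · rintro L ⟨⟨h1, h2, h3⟩, -⟩
          refine ⟨⟨?_, ?_, ?_⟩, Nat.zero_le _⟩
          · simp only [List.map_cons, List.forall_mem_cons]
            exact ⟨by simp, h1⟩
          · simp [h2, add_comm]
          · rw [List.map_cons, List.length_cons, h3]
        · rw [wordSym_prepend, letterSym_singleton]
      | zero => rw [map_zero, zero_mul]; exact zero_mem _
      | add v w _ _ h h' => rw [map_add, add_mul]; exact add_mem h h'
      | smul r v _ h => rw [map_smul, smul_mul_assoc]; exact Submodule.smul_mem _ r h
  exact key hs

end Realization

/-! ### Exactness -/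

section Exactness

variable {k V : Type*} [CommRing k] [AddCommGroup V] [Module k V] {ι : Type*} [LinearOrder ι]

theorem delta_delta_realize (b : Module.Basis ι k V) {t p m : ℕ} {x : WordModule k ι}
    (hx : x ∈ wordFiltration k ι t p m) :
    delta k V t (p + 1) (delta k V t p (realize b t p x)) = 0 := by
  rw [delta_realize b hx, delta_realize b (wordDelta_sign_mem hx), wordDelta_wordDelta, map_zero]

theorem exact_delta_delta (b : Module.Basis ι k V) {t p : ℕ} (hp : p + 1 < t) :
    Function.Exact (delta k V t p) (delta k V t (p + 1)) := by
  intro x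
  constructor
  · intro hx
    obtain ⟨x, hxm, rfl⟩ := exists_realize_eq b x
    rw [delta_realize b hxm] at hx
    have hδ : wordDelta (sign k) x = 0 := by
      rw [← coord_realize b (wordDelta_sign_mem hxm), hx, map_zero]
    obtain ⟨y, hy, hxy⟩ := exists_sub_wordDelta_mem_standardSpan 0 hxm hδ
    rw [standardSpan_eq_bot hp.ne, Submodule.mem_bot, sub_eq_zero] at hxy
    exact ⟨realize b t p y, by rw [delta_realize b hy, hxy]⟩
  · rintro ⟨y, rfl⟩
    obtain ⟨y, hy, rfl⟩ := exists_realize_eq b y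
    exact delta_delta_realize b hy

theorem exact_delta_proj (b : Module.Basis ι k V) {t p : ℕ} (h : p + 1 = t) :
    Function.Exact (delta k V t p) (proj k V h) := by
  intro x
  constructor
  · intro hx
    obtain ⟨x, hxm, rfl⟩ := exists_realize_eq b x
    have hx0 : wordSym b x = 0 := by rw [← proj_realize b h hxm, hx, Submodule.coe_zero]
    have hδ : wordDelta (sign k) x = 0 := by
      have := wordDelta_sign_mem hxm
      rwa [wordFiltration_eq_bot_of_lt (by omega), Submodule.mem_bot] at this
    obtain ⟨y, hy, hxy⟩ := exists_sub_wordDelta_mem_standardSpan 0 hxm hδ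
    have hz := eq_zero_of_mem_standardSpan b hxy (by
      rw [map_sub, hx0, wordSym_wordDelta, sub_zero])
    rw [sub_eq_zero] at hz
    exact ⟨realize b t p y, by rw [delta_realize b hy, hz]⟩
  · rintro ⟨y, rfl⟩
    obtain ⟨y, hy, rfl⟩ := exists_realize_eq b y
    apply Subtype.ext
    rw [delta_realize b hy, proj_realize b h (wordDelta_sign_mem hy), wordSym_wordDelta]
    rfl

theorem proj_surjective (b : Module.Basis ι k V) (t : ℕ) :
    Function.Surjective (proj k V (rfl : t = t)) := by
  rintro ⟨s, hs⟩
  obtain ⟨x, hx, rfl⟩ := exists_wordSym_eq b hs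
  exact ⟨realize b t t x, Subtype.ext (proj_realize b rfl hx)⟩

theorem subsingleton_T_zero (k V : Type*) [CommRing k] [AddCommGroup V] [Module k V] {t : ℕ}
    (ht : 1 ≤ t) : Subsingleton (T k V t 0) := by
  have : IsEmpty {l : List ℕ // IsComposition t 0 l} := by
    refine ⟨fun l => ?_⟩
    have h := List.length_eq_zero_iff.1 l.2.2.2
    have h' := l.2.2.1
    rw [h, List.sum_nil] at h'
    omega
  exact ⟨fun x y => DFinsupp.ext fun c => this.elim c⟩

end Exactness

end KoszulInversion

end

open KoszulInversion in
/-- For `t ≥ 1` the sequence `0 → T_t^1 → ⋯ → T_t^t → S^t V → 0` is exact. Here `T_t^0 = 0` is the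
zero term on the left; `p + 1` runs through `1, …, t - 1` in the second clause, and `p + 1 = t` in
the third one. -/
theorem theorem2 {k V : Type*} [Field k] [AddCommGroup V] [Module k V] [FiniteDimensional k V]
    (hn : 2 ≤ Module.finrank k V) (t : ℕ) (ht : 1 ≤ t) :
    Subsingleton (T k V t 0) ∧
    (∀ p : ℕ, p + 1 < t → Function.Exact (delta k V t p) (delta k V t (p + 1))) ∧
    (∀ (p : ℕ) (h : p + 1 = t), Function.Exact (delta k V t p) (proj k V h)) ∧
    Function.Surjective (proj k V (rfl : t = t)) := by

  let b := Module.finBasis k V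
  exact ⟨subsingleton_T_zero k V ht, fun p hp => exact_delta_delta b hp,
    fun p h => exact_delta_proj b h, proj_surjective b t⟩
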